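/- **Setting.** Let $F\subseteq\mathbb R$, $0<\alpha\le 1$, $l\in\mathbb R$. For a subdivision $P=\{x=t_0<\dots<t_n=y\}$ of $[x,y]$ put $\sigma^\alpha[F,P]=\sum_{i<n}\frac{(t_{i+1}-t_i)^\alpha}{\Gamma(\alpha+1)}\Theta(F,[t_i,t_{i+1}])$, where $\Theta(F,I)=1$ if $F\cap I\ne\emptyset$ and $0$ otherwise. Let $\gamma^\alpha(F,x,y)=\lim_{\delta\to0^+}\inf\{\sigma^\alpha[F,P]:\max_i(t_{i+1}-t_i)\le\delta\}$, and let $S=S_F^\alpha$ be the integral staircase function, $S(x)=\gamma^\alpha(F,l,x)$ for $x\ge l$ and $S(x)=-\gamma^\alpha(F,x,l)$ for $x<l$. Assume that $\gamma^\alpha(F,x,y)<\infty$ for all $x\le y$, that $S(0)=0$, and that $S(t)\to\infty$ as $t\to\infty$. For $f$ bounded on $F\cap[x,y]$, the integral $\int_x^y f\,d_F^\alpha t$ is the common value, if they agree, of the supremum over subdivisions of $\sum_i\inf_{F\cap[t_i,t_{i+1}]}f\,\cdot(S(t_{i+1})-S(t_i))$ and the infimum of $\sum_i\sup_{F\cap[t_i,t_{i+1}]}f\,\cdot(S(t_{i+1})-S(t_i))$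 (an infimum or supremum over the empty set counts as $0$), and $\int_0^\infty f\,d_F^\alpha t=\lim_{b\to\infty}\int_0^b f\,d_F^\alpha t$. The fractal Sumudu transform of $f$ at $v$ is $$\mathscr S[f](v)=\frac1{S(v)}\int_0^\infty e^{-S(t)/S(v)}f(t)\,d_F^\alpha t,$$ if the integral exists. For $\beta>0$ and $a\in\mathbb R$ the fractal Mittag-Leffler function of order $\beta$ gives $$E_F^\alpha(-at^\beta)=\sum_{j=0}^\infty\frac{(-a\,S(t)^\beta)^j}{\Gamma_F^\alpha(\beta j+1)},\qquad \Gamma_F^\alpha(s)=\int_0^\infty e^{-S(t)}S(t)^{s-1}\,d_F^\alpha t,$$ where $s$ is the staircase value of the argument of the fractal Gamma function. **Lemma.** Let $\beta>0$, $a\in\mathbb R$, and let $v$ satisfy $S(v)>0$. (i) If $\mathscr S[E_F^\alpha(-at^\beta)](v)$ exists, then $1+aS(v)^\beta\ne0$ and $$\mathscr S\big[E_F^\alpha(-at^\beta)\big](v)=\frac1{1+a\,S(v)^\beta}.$$ (ii) If $\mathscr S[1-E_F^\alpha(-at^\beta)](v)$ exists, then $1+aS(v)^\beta\ne0$ and $$\mathscr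 S\big[1-E_F^\alpha(-at^\beta)\big](v)=\frac{a\,S(v)^\beta}{1+a\,S(v)^\beta}.$$ Both transforms exist if $|a|\,S(v)^\beta<1$, and, when $a\ge0$ and $\beta\le1$, for every $v$ with $S(v)>0$. -/

import Mathlib

open Filter Topology
open scoped ENNReal

/-- A subdivision `x = t₀ < t₁ < ⋯ < tₙ = y` of the interval `[x, y]`
(only the values `pt 0, …, pt n` matter). -/
structure Subdivision (x y : ℝ) where
  n : ℕ
  pt : ℕ → ℝ
  pt_zero : pt 0 = x
  pt_last : pt n = y
  lt_succ : ∀ i < n, pt i < pt (i + 1)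

/-- `|P| ≤ δ`: every interval of the subdivision has length at most `δ`. -/
def Subdivision.MeshLE {x y : ℝ} (P : Subdivision x y) (δ : ℝ) : Prop :=
  ∀ i < P.n, P.pt (i + 1) - P.pt i ≤ δ

open Classical in
/-- The flag function `Θ(F, I)`: `1` if `F ∩ I` is non-empty, and `0` otherwise. -/
noncomputable def flag (F I : Set ℝ) : ℝ :=
  if (F ∩ I).Nonempty then 1 else 0

/-- `σ^α[F, P] = ∑ (t_{i+1} - t_i)^α / Γ(α + 1) * Θ(F, [t_i, t_{i+1}])`.
It is `0` when `x = y`, the sum being empty then. -/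
noncomputable def Subdivision.sigma {x y : ℝ} (P : Subdivision x y) (F : Set ℝ) (α : ℝ) : ℝ :=
  ∑ i ∈ Finset.range P.n,
    (P.pt (i + 1) - P.pt i) ^ α / Real.Gamma (α + 1) * flag F (Set.Icc (P.pt i) (P.pt (i + 1)))

/-- The coarse-grained mass `γ_δ^α(F, x, y)`, for `x ≤ y`. -/
noncomputable def coarseMass (F : Set ℝ) (α δ x y : ℝ) : ℝ≥0∞ :=
  ⨅ (P : Subdivision x y) (_ : P.MeshLE δ), ENNReal.ofReal (P.sigma F α)

/-- The mass function `γ^α(F, x, y)`, for `x ≤ y`: the limit of `γ_δ^α(F, x, y)` as `δ` decreases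
to `0` (see `tendsto_coarseMass`). The value `∞` is possible. -/
noncomputable def massFunction (F : Set ℝ) (α x y : ℝ) : ℝ≥0∞ :=
  ⨆ (δ : ℝ) (_ : 0 < δ), coarseMass F α δ x y

theorem tendsto_coarseMass (F : Set ℝ) (α x y : ℝ) :
    Tendsto (fun δ => coarseMass F α δ x y) (𝓝[>] 0) (𝓝 (massFunction F α x y)) := by
  have hanti : Antitone (fun δ => coarseMass F α δ x y) := by
    intro δ₁ δ₂ h
    refine iInf_mono fun P => ?_
    exact iInf_mono' fun hP => ⟨fun i hi => (hP i hi).trans h, le_rfl⟩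
  have := hanti.tendsto_nhdsGT 0
  rwa [sSup_image] at this

open Classical in
/-- The integral staircase function `S_F^α` of order `α` with base point `l`. -/
noncomputable def staircase (F : Set ℝ) (α l x : ℝ) : ℝ :=
  if l ≤ x then (massFunction F α l x).toReal else -(massFunction F α x l).toReal

/-- The upper `F^α`-sum of `f`. The supremum is over `F ∩ [t_i, t_{i+1}]`, and it counts as `0`
where that set is empty (the supremum of the empty set of reals is `0` in Mathlib). -/
noncomputable def Subdivision.upperSum {x y : ℝ} (P : Subdivision x y) (F : Set ℝ) (α l : ℝ)
    (f : ℝ → ℝ) : ℝ :=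
  ∑ i ∈ Finset.range P.n,
    sSup (f '' (F ∩ Set.Icc (P.pt i) (P.pt (i + 1)))) *
      (staircase F α l (P.pt (i + 1)) - staircase F α l (P.pt i))

/-- The lower `F^α`-sum of `f`, with the same convention. -/
noncomputable def Subdivision.lowerSum {x y : ℝ} (P : Subdivision x y) (F : Set ℝ) (α l : ℝ)
    (f : ℝ → ℝ) : ℝ :=
  ∑ i ∈ Finset.range P.n,
    sInf (f '' (F ∩ Set.Icc (P.pt i) (P.pt (i + 1)))) *
      (staircase F α l (P.pt (i + 1)) - staircase F α l (P.pt i))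

/-- `f` is `F^α`-integrable on `[x, y]` with `∫_x^y f(t) d_F^α t = I`: `f` is bounded on
`F ∩ [x, y]`, and its lower integral (the supremum of the lower sums) and its upper integral
(the infimum of the upper sums) both equal `I`. -/
def HasFractalIntegral (F : Set ℝ) (α l : ℝ) (f : ℝ → ℝ) (x y I : ℝ) : Prop :=
  BddAbove (f '' (F ∩ Set.Icc x y)) ∧ BddBelow (f '' (F ∩ Set.Icc x y)) ∧
    IsLUB (Set.range fun P : Subdivision x y => P.lowerSum F α l f) I ∧
    IsGLB (Set.range fun P : Subdivision x y => P.upperSum F α l f) I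

/-- `∫_0^∞ f(t) d_F^α t` exists and equals `I`, as the limit of `∫_0^b f(t) d_F^α t` when
`b → ∞`. -/
def HasFractalImproperIntegral (F : Set ℝ) (α l : ℝ) (f : ℝ → ℝ) (I : ℝ) : Prop :=
  ∃ G : ℝ → ℝ, (∀ b, 0 ≤ b → HasFractalIntegral F α l f 0 b (G b)) ∧ Tendsto G atTop (𝓝 I)

open Classical in
/-- The value of `∫_0^∞ f(t) d_F^α t` (and `0` if the integral does not exist). -/
noncomputable def fractalImproperIntegral (F : Set ℝ) (α l : ℝ) (f : ℝ → ℝ) : ℝ :=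
  if h : ∃ I, HasFractalImproperIntegral F α l f I then h.choose else 0

/-- The fractal Gamma function `∫_0^∞ e^{-S(t)} S(t)^{s - 1} d_F^α t`, with `S = S_F^α`, as a
function of the staircase value `s` of its argument. It is used for `s ≥ 1` only, where the
integrand is bounded on bounded intervals. -/
noncomputable def fractalGamma (F : Set ℝ) (α l s : ℝ) : ℝ :=
  fractalImproperIntegral F α l fun t =>
    Real.exp (-staircase F α l t) * staircase F α l t ^ (s - 1)

/-- The fractal Mittag-Leffler series `∑_j z^j / Γ_F^α(η j + ν)` as a function of the staircase
value `z` of its argument. -/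
noncomputable def fractalMittagLeffler (F : Set ℝ) (α l η ν z : ℝ) : ℝ :=
  ∑' j : ℕ, z ^ j / fractalGamma F α l (η * j + ν)

/-- The function `t ↦ E_F^α(-a t^β)`, that is, the fractal Mittag-Leffler function of order `β`
(parameters `η = β`, `ν = 1`) at the staircase value `-a S_F^α(t)^β`. -/
noncomputable def mittagLefflerNegPow (F : Set ℝ) (α l a β t : ℝ) : ℝ :=
  fractalMittagLeffler F α l β 1 (-a * staircase F α l t ^ β)

/-- The fractal Sumudu transform of `f` at `v`, namely
`(1 / S(v)) ∫_0^∞ e^{-S(t) / S(v)} f(t) d_F^α t` with `S = S_F^α`, exists and equals `c`. -/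
def HasFractalSumudu (F : Set ℝ) (α l : ℝ) (f : ℝ → ℝ) (v c : ℝ) : Prop :=
  ∃ I, HasFractalImproperIntegral F α l
      (fun t => Real.exp (-(staircase F α l t / staircase F α l v)) * f t) I ∧
    c = 1 / staircase F α l v * I

/-!
The staircase function `S` is continuous and monotone and increases only on `F`, so that fractal
integrals of functions of `S` are Riemann integrals in the variable `u = S(t)`. Hence the fractal
Gamma function is the classical one, and the Sumudu transform of `E_β(-a S(t)^β)` at `v` is the
improper integral of `h(x) = e^{-x} E_β(c x^β)` over the half-line, where `c = -a S(v)^β`.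

By the Beta integral, `E_β(c x^β)` solves the Volterra equation `y = 1 + c k ∗ y` with
`k(r) = r^{β-1} / Γ(β)`. Multiplying by `e^{-x}` gives `h = e^{-x} + c γ ∗ h`, where
`γ(r) = e^{-r} k(r)` is a probability density; since convolution with an integrable function
multiplies even conditionally convergent integrals, `∫ h = 1 + c ∫ h`. For `|c| < 1` the integral
converges absolutely term by term. For `c ≤ 0` and `β ≤ 1` the kernel `k` is decreasing, which
forces `0 < E_β(c x^β) ≤ 1`.
-/

/-! ### Subdivisions -/

namespace Subdivision

variable {x y z : ℝ}

/-- The sum `∑ φ(tᵢ, tᵢ₊₁)` of an interval function `φ` over a subdivision. By definition, `sigma`,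
`upperSum` and `lowerSum` are all of this form. -/
def sum (P : Subdivision x y) (φ : ℝ → ℝ → ℝ) : ℝ :=
  ∑ i ∈ Finset.range P.n, φ (P.pt i) (P.pt (i + 1))

/-- The subdivision of the degenerate interval `[x, x]`, which has no subintervals. -/
def degenerate (x : ℝ) : Subdivision x x where
  n := 0
  pt _ := x
  pt_zero := rfl
  pt_last := rfl
  lt_succ i hi := absurd hi i.not_lt_zero

/-- The subdivision of `[x, y]` with a single subinterval. -/
def single (h : x < y) : Subdivision x y where
  n := 1
  pt i := if i = 0 then x else y
  pt_zero := rfl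
  pt_last := rfl
  lt_succ i hi := by
    obtain rfl : i = 0 := by lia
    simpa using h

/-- The initial part, up to the `k`-th point, of a subdivision. -/
def take (P : Subdivision x y) (k : ℕ) (hk : k ≤ P.n) : Subdivision x (P.pt k) where
  n := k
  pt := P.pt
  pt_zero := P.pt_zero
  pt_last := rfl
  lt_succ i hi := P.lt_succ i (hi.trans_le hk)

/-- The concatenation of subdivisions of two adjacent intervals. -/
def append (P : Subdivision x y) (Q : Subdivision y z) : Subdivision x z where
  n := P.n + Q.n
  pt i := if i < P.n then P.pt i else Q.pt (i - P.n)
  pt_zero := by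
    rcases P.n.eq_zero_or_pos with h | h
    · have hyx : y = x := by rw [← P.pt_last, h, P.pt_zero]
      simp [h, Q.pt_zero, hyx]
    · simp [h, P.pt_zero]
  pt_last := by simp [Q.pt_last]
  lt_succ i hi := by
    rcases lt_trichotomy (i + 1) P.n with h | h | h
    · have h' : i < P.n := by lia
      simpa [h, h'] using P.lt_succ i h'
    · have h' : i < P.n := by lia
      have hlt := P.lt_succ i h'
      rw [h, P.pt_last] at hlt
      simpa [h, h', Q.pt_zero] using hlt
    · have h' : ¬ i < P.n := by lia
      have h'' : ¬ i + 1 < P.n := by lia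
      have hsub : i + 1 - P.n = (i - P.n) + 1 := by lia
      simpa [h', h'', hsub] using Q.lt_succ (i - P.n) (by lia)

theorem append_pt_left (P : Subdivision x y) (Q : Subdivision y z) {i : ℕ} (hi : i ≤ P.n) :
    (P.append Q).pt i = P.pt i := by
  rcases hi.lt_or_eq with hi | rfl
  · simp [append, hi]
  · simp [append, P.pt_last, Q.pt_zero]

theorem append_pt_right (P : Subdivision x y) (Q : Subdivision y z) (i : ℕ) :
    (P.append Q).pt (P.n + i) = Q.pt i := by
  simp [append]

theorem append_n (P : Subdivision x y) (Q : Subdivision y z) :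
    (P.append Q).n = P.n + Q.n := rfl

theorem MeshLE.append {P : Subdivision x y} {Q : Subdivision y z} {δ : ℝ} (hP : P.MeshLE δ)
    (hQ : Q.MeshLE δ) : (P.append Q).MeshLE δ := by
  intro i hi
  rw [append_n] at hi
  rcases lt_or_ge i P.n with h | h
  · rw [append_pt_left _ _ h, append_pt_left _ _ h.le]
    exact hP i h
  · obtain ⟨j, rfl⟩ := Nat.exists_eq_add_of_le h
    rw [add_assoc, append_pt_right, append_pt_right]
    exact hQ j (by lia)

theorem sum_append (P : Subdivision x y) (Q : Subdivision y z) (φ : ℝ → ℝ → ℝ) :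
    (P.append Q).sum φ = P.sum φ + Q.sum φ := by
  rw [sum, append_n, Finset.sum_range_add]
  congr 1
  · refine Finset.sum_congr rfl fun i hi => ?_
    have hi := Finset.mem_range.1 hi
    rw [append_pt_left _ _ hi, append_pt_left _ _ hi.le]
  · refine Finset.sum_congr rfl fun i _ => ?_
    rw [add_assoc, append_pt_right, append_pt_right]

theorem pt_mono (P : Subdivision x y) {i j : ℕ} (hij : i ≤ j) (hj : j ≤ P.n) :
    P.pt i ≤ P.pt j := by
  induction j, hij using Nat.le_induction with
  | base => exact le_rfl
  | succ k _ ih => exact (ih (by lia)).trans (P.lt_succ k (by lia)).le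

theorem Icc_pt_subset (P : Subdivision x y) {i : ℕ} (hi : i < P.n) :
    Set.Icc (P.pt i) (P.pt (i + 1)) ⊆ Set.Icc x y :=
  Set.Icc_subset_Icc (by simpa only [P.pt_zero] using P.pt_mono i.zero_le hi.le)
    (by simpa only [P.pt_last] using P.pt_mono hi le_rfl)

theorem sum_sub (P : Subdivision x y) (Φ : ℝ → ℝ) :
    P.sum (fun s t => Φ t - Φ s) = Φ y - Φ x := by
  rw [sum, Finset.sum_range_sub (fun i => Φ (P.pt i)), P.pt_zero, P.pt_last]

theorem exists_meshLE_sum_eq {φ : ℝ → ℝ → ℝ} (hφ : ∀ s, φ s s = 0) (hxy : x ≤ y) {δ : ℝ}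
    (hδ : y - x ≤ δ) : ∃ P : Subdivision x y, P.MeshLE δ ∧ P.sum φ = φ x y := by
  rcases hxy.lt_or_eq with h | rfl
  · refine ⟨single h, fun i hi => ?_, by simp [single, sum]⟩
    obtain rfl : i = 0 := Nat.lt_one_iff.1 hi
    simpa [single] using hδ
  · exact ⟨degenerate x, fun i hi => absurd hi i.not_lt_zero, by simp [degenerate, sum, hφ]⟩

theorem exists_meshLE (hxy : x ≤ y) {δ : ℝ} (hδ : 0 < δ) :
    ∃ P : Subdivision x y, P.MeshLE δ := by
  rcases hxy.eq_or_lt with rfl | hlt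
  · exact ⟨degenerate x, fun i hi => absurd hi i.not_lt_zero⟩
  obtain ⟨n, hn⟩ := exists_nat_gt ((y - x) / δ)
  have hn0 : (0 : ℝ) < n := (div_pos (sub_pos.2 hlt) hδ).trans hn
  have hstep : 0 < (y - x) / n := div_pos (sub_pos.2 hlt) hn0
  refine ⟨⟨n, fun i => x + i * ((y - x) / n), by simp, by field_simp; ring,
    fun i _ => by push_cast; linarith⟩, fun i _ => ?_⟩
  rw [div_lt_iff₀ hδ] at hn
  calc x + (i + 1 : ℕ) * ((y - x) / n) - (x + i * ((y - x) / n)) = (y - x) / n := by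
        push_cast; ring
    _ ≤ δ := (div_le_iff₀' hn0).2 hn.le

theorem exists_split {φ : ℝ → ℝ → ℝ} {δ C : ℝ} (hδ : 0 ≤ δ) (hφ₀ : ∀ s, φ s s = 0)
    (hφ : ∀ s t, s ≤ t → t - s ≤ δ → φ s t ∈ Set.Icc 0 C) (P : Subdivision x z)
    (hP : P.MeshLE δ) (hxy : x ≤ y) (hyz : y ≤ z) :
    ∃ (Q : Subdivision x y) (R : Subdivision y z), Q.MeshLE δ ∧ R.MeshLE δ ∧
      Q.sum φ + R.sum φ ≤ P.sum φ + 2 * C := by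
  induction hn : P.n generalizing z with
  | zero =>
    obtain rfl : x = z := by rw [← P.pt_zero, ← hn, P.pt_last]
    obtain rfl : x = y := le_antisymm hxy hyz
    have hx : φ x x ∈ Set.Icc 0 C := hφ x x le_rfl (by simpa using hδ)
    refine ⟨P, P, hP, hP, ?_⟩
    simp only [sum, hn, Finset.range_zero, Finset.sum_empty]
    linarith [hx.1.trans hx.2]
  | succ n ih =>
    have hlast : P.pt (n + 1) = z := by rw [← hn, P.pt_last]
    have hlt : P.pt n < z := by simpa only [hlast] using P.lt_succ n (by lia)
    have hmesh : z - P.pt n ≤ δ := by simpa only [hlast] using hP n (by lia)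
    have hnP : n ≤ P.n := by lia
    have htake : (P.take n hnP).MeshLE δ := fun i hi => hP i (lt_of_lt_of_le hi hnP)
    have hsum : P.sum φ = (P.take n hnP).sum φ + φ (P.pt n) z := by
      rw [sum, hn, Finset.sum_range_succ, hlast]
      rfl
    rcases le_total y (P.pt n) with hy | hy
    · obtain ⟨Q, R, hQ, hR, hQR⟩ := ih (P.take n hnP) htake hy rfl
      obtain ⟨T, hT, hTφ⟩ := exists_meshLE_sum_eq hφ₀ hlt.le hmesh
      refine ⟨Q, R.append T, hQ, hR.append hT, ?_⟩
      rw [sum_append]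
      linarith
    · obtain ⟨T, hT, hTφ⟩ := exists_meshLE_sum_eq hφ₀ hy (by linarith : y - P.pt n ≤ δ)
      obtain ⟨R, hR, hRφ⟩ := exists_meshLE_sum_eq hφ₀ hyz (by linarith : z - y ≤ δ)
      refine ⟨(P.take n hnP).append T, R, htake.append hT, hR, ?_⟩
      rw [sum_append]
      linarith [(hφ _ _ hlt.le hmesh).1, (hφ _ _ hy (by linarith)).2,
        (hφ _ _ hyz (by linarith)).2]

end Subdivision

/-! ### The mass function and the staircase -/

section Mass

variable {F : Set ℝ} {α δ x y z : ℝ}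

/-- The contribution of the interval `[s, t]` to `σ^α[F, P]`. -/
noncomputable def intervalMass (F : Set ℝ) (α s t : ℝ) : ℝ :=
  (t - s) ^ α / Real.Gamma (α + 1) * flag F (Set.Icc s t)

theorem sigma_eq_sum_intervalMass (P : Subdivision x y) (F : Set ℝ) (α : ℝ) :
    P.sigma F α = P.sum (intervalMass F α) := rfl

theorem intervalMass_self (hα : 0 < α) (s : ℝ) : intervalMass F α s s = 0 := by
  simp [intervalMass, hα.ne']

theorem intervalMass_mem_Icc (hα : 0 < α) {s t : ℝ} (hst : s ≤ t) (hδ : t - s ≤ δ) :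
    intervalMass F α s t ∈ Set.Icc 0 (δ ^ α / Real.Gamma (α + 1)) := by
  have hΓ : 0 < Real.Gamma (α + 1) := Real.Gamma_pos_of_pos (by linarith)
  have hlen : 0 ≤ t - s := sub_nonneg.2 hst
  have hδ₀ : 0 ≤ δ := hlen.trans hδ
  rw [intervalMass, flag]
  split_ifs
  · rw [mul_one]
    exact ⟨div_nonneg (Real.rpow_nonneg hlen α) hΓ.le, div_le_div_of_nonneg_right (by gcongr) hΓ.le⟩
  · rw [mul_zero]
    exact ⟨le_rfl, div_nonneg (Real.rpow_nonneg hδ₀ α) hΓ.le⟩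

theorem Subdivision.sigma_nonneg (P : Subdivision x y) (F : Set ℝ) (hα : 0 < α) :
    0 ≤ P.sigma F α :=
  Finset.sum_nonneg fun i hi =>
    (intervalMass_mem_Icc hα (P.lt_succ i (Finset.mem_range.1 hi)).le le_rfl).1

theorem coarseMass_le_massFunction (hδ : 0 < δ) :
    coarseMass F α δ x y ≤ massFunction F α x y :=
  le_iSup₂ (f := fun (δ : ℝ) (_ : 0 < δ) => coarseMass F α δ x y) δ hδ

theorem coarseMass_le_add (hα : 0 < α) (δ x y z : ℝ) :
    coarseMass F α δ x z ≤ coarseMass F α δ x y + coarseMass F α δ y z := by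
  simp only [coarseMass, ENNReal.iInf_add, ENNReal.add_iInf]
  refine le_iInf₂ fun Q hQ => le_iInf₂ fun P hP => ?_
  refine (iInf₂_le (P.append Q) (hP.append hQ)).trans_eq ?_
  rw [← ENNReal.ofReal_add (P.sigma_nonneg F hα) (Q.sigma_nonneg F hα),
    sigma_eq_sum_intervalMass, Subdivision.sum_append]
  rfl

theorem coarseMass_add_le (hα : 0 < α) (hδ : 0 ≤ δ) (hxy : x ≤ y) (hyz : y ≤ z) :
    coarseMass F α δ x y + coarseMass F α δ y z ≤
      coarseMass F α δ x z + ENNReal.ofReal (2 * (δ ^ α / Real.Gamma (α + 1))) := by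
  have herr : 0 ≤ 2 * (δ ^ α / Real.Gamma (α + 1)) :=
    mul_nonneg zero_le_two (div_nonneg (Real.rpow_nonneg hδ α)
      (Real.Gamma_nonneg_of_nonneg (by linarith)))
  rw [coarseMass.eq_1 F α δ x z]
  simp only [ENNReal.iInf_add]
  refine le_iInf₂ fun P hP => ?_
  obtain ⟨Q, R, hQ, hR, hQR⟩ := P.exists_split hδ (intervalMass_self (F := F) hα)
    (fun _ _ => intervalMass_mem_Icc hα) hP hxy hyz
  calc coarseMass F α δ x y + coarseMass F α δ y z
      ≤ ENNReal.ofReal (Q.sigma F α) + ENNReal.ofReal (R.sigma F α) :=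
        add_le_add (iInf₂_le Q hQ) (iInf₂_le R hR)
    _ = ENNReal.ofReal (Q.sigma F α + R.sigma F α) :=
        (ENNReal.ofReal_add (Q.sigma_nonneg F hα) (R.sigma_nonneg F hα)).symm
    _ ≤ ENNReal.ofReal (P.sigma F α + 2 * (δ ^ α / Real.Gamma (α + 1))) :=
        ENNReal.ofReal_le_ofReal hQR
    _ = _ := ENNReal.ofReal_add (P.sigma_nonneg F hα) herr

theorem coarseMass_le_ofReal (hα : 0 < α) (hxy : x ≤ y) (hδ : y - x ≤ δ) :
    coarseMass F α δ x y ≤ ENNReal.ofReal (δ ^ α / Real.Gamma (α + 1)) := by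
  obtain ⟨P, hP, hPσ⟩ := Subdivision.exists_meshLE_sum_eq (intervalMass_self (F := F) hα) hxy hδ
  refine (iInf₂_le P hP).trans (ENNReal.ofReal_le_ofReal ?_)
  exact hPσ.trans_le (intervalMass_mem_Icc hα hxy hδ).2

theorem tendsto_rpow_div_nhdsGT_zero (hα : 0 < α) (c : ℝ) :
    Tendsto (fun δ : ℝ => δ ^ α / c) (𝓝[>] 0) (𝓝 0) := by
  have hcont : Continuous fun δ : ℝ => δ ^ α / c :=
    (Real.continuous_rpow_const hα.le).div_const c
  simpa [hα.ne'] using (hcont.tendsto 0).mono_left nhdsWithin_le_nhds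

theorem massFunction_add (hα : 0 < α) (hxy : x ≤ y) (hyz : y ≤ z) :
    massFunction F α x y + massFunction F α y z = massFunction F α x z := by
  have hsum := (tendsto_coarseMass F α x y).add (tendsto_coarseMass F α y z)
  refine le_antisymm ?_ ?_
  · have herr := ENNReal.tendsto_ofReal
      ((tendsto_rpow_div_nhdsGT_zero hα (Real.Gamma (α + 1))).const_mul 2)
    rw [mul_zero, ENNReal.ofReal_zero] at herr
    have hsplit := (tendsto_coarseMass F α x z).add herr
    rw [add_zero] at hsplit
    refine le_of_tendsto_of_tendsto hsum hsplit ?_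
    filter_upwards [self_mem_nhdsWithin] with δ hδ
    exact coarseMass_add_le hα (le_of_lt hδ) hxy hyz
  · exact le_of_tendsto_of_tendsto' (tendsto_coarseMass F α x z) hsum
      fun δ => coarseMass_le_add hα δ x y z

theorem massFunction_eq_zero_of_disjoint (hxy : x ≤ y) (hF : Disjoint F (Set.Icc x y)) :
    massFunction F α x y = 0 := by
  refine nonpos_iff_eq_zero.1 (iSup₂_le fun δ hδ => ?_)
  obtain ⟨P, hP⟩ := Subdivision.exists_meshLE hxy hδ
  have hσ : P.sigma F α = 0 := by
    refine Finset.sum_eq_zero fun i hi => ?_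
    have hempty := hF.mono_right (P.Icc_pt_subset (Finset.mem_range.1 hi))
    simp [flag, hempty.inter_eq]
  exact (iInf₂_le P hP).trans (by simp [hσ])

/-- The finiteness hypothesis on the mass function: every compact interval has finite mass. -/
def LocallyFiniteMass (F : Set ℝ) (α : ℝ) : Prop :=
  ∀ x y : ℝ, x ≤ y → massFunction F α x y ≠ ∞

theorem massFunction_le_coarseMass_add (hα : 0 < α) (hF : LocallyFiniteMass F α) (hδ : 0 < δ)
    {A B : ℝ} {η : ℝ≥0∞} (hη : massFunction F α A B ≤ coarseMass F α δ A B + η) (hAx : A ≤ x)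
    (hxy : x ≤ y) (hyB : y ≤ B) :
    massFunction F α x y ≤ coarseMass F α δ x y + η := by
  have hle : massFunction F α A x + (massFunction F α x y + massFunction F α y B) ≤
      massFunction F α A x + (coarseMass F α δ x y + η + massFunction F α y B) :=
    calc massFunction F α A x + (massFunction F α x y + massFunction F α y B)
        = massFunction F α A B := by
          rw [massFunction_add hα hxy hyB, massFunction_add hα hAx (hxy.trans hyB)]
      _ ≤ coarseMass F α δ A B + η := hη
      _ ≤ coarseMass F α δ A x + (coarseMass F α δ x y + coarseMass F α δ y B) + η := by
          gcongr
          exact (coarseMass_le_add hα δ A x B).trans (by gcongr; exact coarseMass_le_add hα δ x y B)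
      _ ≤ massFunction F α A x + (coarseMass F α δ x y + massFunction F α y B) + η := by
          gcongr <;> exact coarseMass_le_massFunction hδ
      _ = massFunction F α A x + (coarseMass F α δ x y + η + massFunction F α y B) := by ring
  rwa [ENNReal.add_le_add_iff_left (hF A x hAx),
    ENNReal.add_le_add_iff_right (hF y B hyB)] at hle

theorem exists_forall_massFunction_le (hα : 0 < α) (hF : LocallyFiniteMass F α) {A B ε : ℝ}
    (hAB : A ≤ B) (hε : 0 < ε) :
    ∃ δ > 0, ∀ x y, A ≤ x → x ≤ y → y ≤ B → y - x ≤ δ →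
      massFunction F α x y ≤ ENNReal.ofReal ε := by
  have hmass : ∀ᶠ δ in 𝓝[>] (0 : ℝ),
      massFunction F α A B ≤ coarseMass F α δ A B + ENNReal.ofReal (ε / 2) := by
    have hsum := (tendsto_coarseMass F α A B).add_const (ENNReal.ofReal (ε / 2))
    refine (hsum.eventually (lt_mem_nhds ?_)).mono fun _ => le_of_lt
    exact ENNReal.lt_add_right (hF A B hAB) (by simpa using hε)
  have herr : ∀ᶠ δ in 𝓝[>] (0 : ℝ), δ ^ α / Real.Gamma (α + 1) < ε / 2 :=
    (tendsto_rpow_div_nhdsGT_zero hα _).eventually_lt_const (half_pos hε)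
  obtain ⟨δ, ⟨hmassδ, herrδ⟩, hδ : 0 < δ⟩ := ((hmass.and herr).and self_mem_nhdsWithin).exists
  refine ⟨δ, hδ, fun x y hAx hxy hyB hyx => ?_⟩
  calc massFunction F α x y ≤ coarseMass F α δ x y + ENNReal.ofReal (ε / 2) :=
        massFunction_le_coarseMass_add hα hF hδ hmassδ hAx hxy hyB
    _ ≤ ENNReal.ofReal (ε / 2) + ENNReal.ofReal (ε / 2) := by
        gcongr
        exact (coarseMass_le_ofReal hα hxy hyx).trans (ENNReal.ofReal_le_ofReal herrδ.le)
    _ = ENNReal.ofReal ε := by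
        rw [← ENNReal.ofReal_add (half_pos hε).le (half_pos hε).le, add_halves]

end Mass

section Staircase

variable {F : Set ℝ} {α l x y : ℝ}

theorem staircase_sub (hα : 0 < α) (hF : LocallyFiniteMass F α) (hxy : x ≤ y) :
    staircase F α l y - staircase F α l x = (massFunction F α x y).toReal := by
  have hadd {a b c : ℝ} (hab : a ≤ b) (hbc : b ≤ c) : (massFunction F α a c).toReal =
      (massFunction F α a b).toReal + (massFunction F α b c).toReal := by
    rw [← massFunction_add hα hab hbc, ENNReal.toReal_add (hF a b hab) (hF b c hbc)]
  rw [staircase, staircase]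
  split_ifs with hy hx hx
  · rw [hadd hx hxy]; ring
  · rw [hadd (not_le.1 hx).le hy]; ring
  · exact absurd (hx.trans hxy) hy
  · rw [hadd hxy (not_le.1 hy).le]; ring

theorem abs_staircase_sub (hα : 0 < α) (hF : LocallyFiniteMass F α) (x y : ℝ) :
    |staircase F α l x - staircase F α l y| =
      (massFunction F α (min x y) (max x y)).toReal := by
  rcases le_total x y with h | h
  · rw [abs_sub_comm, min_eq_left h, max_eq_right h, staircase_sub hα hF h,
      abs_of_nonneg ENNReal.toReal_nonneg]
  · rw [min_eq_right h, max_eq_left h, staircase_sub hα hF h,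
      abs_of_nonneg ENNReal.toReal_nonneg]

theorem monotone_staircase (hα : 0 < α) (hF : LocallyFiniteMass F α) :
    Monotone (staircase F α l) := fun x y hxy => by
  rw [← sub_nonneg, staircase_sub hα hF hxy]
  exact ENNReal.toReal_nonneg

theorem continuous_staircase (hα : 0 < α) (hF : LocallyFiniteMass F α) :
    Continuous (staircase F α l) := by
  refine Metric.continuous_iff.2 fun x ε hε => ?_
  obtain ⟨δ, hδ, hmass⟩ := exists_forall_massFunction_le hα hF
    (by linarith : x - 1 ≤ x + 1) (half_pos hε)
  refine ⟨min δ 1, by positivity, fun y hy => ?_⟩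
  rw [Real.dist_eq, lt_min_iff] at hy
  obtain ⟨hyl, hyr⟩ := abs_lt.1 hy.2
  have hle : massFunction F α (min y x) (max y x) ≤ ENNReal.ofReal (ε / 2) := by
    refine hmass _ _ (le_min ?_ ?_) min_le_max (max_le ?_ ?_) ?_
    · linarith
    · linarith
    · linarith
    · linarith
    · rw [max_sub_min_eq_abs']
      exact hy.1.le
  rw [Real.dist_eq, abs_staircase_sub hα hF]
  exact (ENNReal.toReal_le_of_le_ofReal (half_pos hε).le hle).trans_lt (half_lt_self hε)

theorem inter_Icc_nonempty_of_staircase_lt (hα : 0 < α) (hF : LocallyFiniteMass F α)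
    (hxy : x ≤ y) (hlt : staircase F α l x < staircase F α l y) :
    (F ∩ Set.Icc x y).Nonempty := by
  contrapose! hlt
  rw [← sub_nonpos, staircase_sub hα hF hxy,
    massFunction_eq_zero_of_disjoint hxy (Set.disjoint_iff_inter_eq_empty.2 hlt),
    ENNReal.toReal_zero]

end Staircase

/-! ### Fractal integrals of functions of the staircase -/

section Integral

variable {F : Set ℝ} {α l x y : ℝ} {g : ℝ → ℝ}

theorem Ioo_staircase_subset_closure_image (hα : 0 < α) (hF : LocallyFiniteMass F α) (hxy : x ≤ y) :
    Set.Ioo (staircase F α l x) (staircase F α l y) ⊆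
      closure (staircase F α l '' (F ∩ Set.Icc x y)) := by
  intro r hr
  refine Metric.mem_closure_iff.2 fun ε hε => ?_
  obtain ⟨q, hrq, hq⟩ := exists_between (lt_min hr.2 (lt_add_of_pos_right r hε))
  rw [lt_min_iff] at hq
  have hivt := intermediate_value_Icc hxy (continuous_staircase (l := l) hα hF).continuousOn
  obtain ⟨t₁, ht₁, rfl⟩ := hivt ⟨hr.1.le, hr.2.le⟩
  obtain ⟨t₂, ht₂, rfl⟩ := hivt ⟨(hr.1.trans hrq).le, hq.1.le⟩
  have hmono := monotone_staircase (l := l) hα hF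
  obtain ⟨p, hpF, hp⟩ :=
    inter_Icc_nonempty_of_staircase_lt hα hF (hmono.reflect_lt hrq).le hrq
  refine ⟨_, ⟨p, ⟨hpF, ht₁.1.trans hp.1, hp.2.trans ht₂.2⟩, rfl⟩, ?_⟩
  rw [dist_comm, Real.dist_eq, abs_sub_lt_iff]
  constructor
  · linarith [hmono hp.2]
  · linarith [hmono hp.1]

theorem bddAbove_image_comp_staircase (hα : 0 < α) (hF : LocallyFiniteMass F α)
    (hg : Continuous g) (x y : ℝ) :
    BddAbove ((fun t => g (staircase F α l t)) '' (F ∩ Set.Icc x y)) :=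
  (isCompact_Icc.bddAbove_image (hg.comp (continuous_staircase hα hF)).continuousOn).mono
    (Set.image_mono Set.inter_subset_right)

theorem bddBelow_image_comp_staircase (hα : 0 < α) (hF : LocallyFiniteMass F α)
    (hg : Continuous g) (x y : ℝ) :
    BddBelow ((fun t => g (staircase F α l t)) '' (F ∩ Set.Icc x y)) :=
  (isCompact_Icc.bddBelow_image (hg.comp (continuous_staircase hα hF)).continuousOn).mono
    (Set.image_mono Set.inter_subset_right)

theorem integral_le_sSup_image_mul (hα : 0 < α) (hF : LocallyFiniteMass F α)
    (hg : Continuous g) (hxy : x ≤ y) :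
    ∫ u in staircase F α l x..staircase F α l y, g u ≤
      sSup ((fun t => g (staircase F α l t)) '' (F ∩ Set.Icc x y)) *
        (staircase F α l y - staircase F α l x) := by
  set M := sSup ((fun t => g (staircase F α l t)) '' (F ∩ Set.Icc x y))
  have hle : closure (staircase F α l '' (F ∩ Set.Icc x y)) ⊆ {r | g r ≤ M} := by
    refine closure_minimal ?_ (isClosed_le hg continuous_const)
    rintro _ ⟨t, ht, rfl⟩
    exact le_csSup (bddAbove_image_comp_staircase hα hF hg x y) ⟨t, ht, rfl⟩
  calc ∫ u in staircase F α l x..staircase F α l y, g u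
      ≤ ∫ _ in staircase F α l x..staircase F α l y, M :=
        intervalIntegral.integral_mono_on_of_le_Ioo (monotone_staircase hα hF hxy)
          (hg.intervalIntegrable _ _) intervalIntegrable_const
          fun _ hr => hle (Ioo_staircase_subset_closure_image hα hF hxy hr)
    _ = M * (staircase F α l y - staircase F α l x) := by
        rw [intervalIntegral.integral_const, smul_eq_mul, mul_comm]

theorem sInf_image_mul_le_integral (hα : 0 < α) (hF : LocallyFiniteMass F α)
    (hg : Continuous g) (hxy : x ≤ y) :
    sInf ((fun t => g (staircase F α l t)) '' (F ∩ Set.Icc x y)) *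
        (staircase F α l y - staircase F α l x) ≤
      ∫ u in staircase F α l x..staircase F α l y, g u := by
  have hneg := integral_le_sSup_image_mul (l := l) hα hF hg.neg hxy
  have himage : (fun t => -g (staircase F α l t)) '' (F ∩ Set.Icc x y) =
      -((fun t => g (staircase F α l t)) '' (F ∩ Set.Icc x y)) := by
    rw [← Set.image_neg_eq_neg, Set.image_image]
  simp only [Pi.neg_apply, himage, intervalIntegral.integral_neg] at hneg
  rw [Real.sInf_def]
  linarith

/-- If `F ∩ [x, y]` is empty, the bound on the oscillation fails, but then `S(x) = S(y)`. -/
theorem sSup_image_mul_le_sInf_image_mul_add {f : ℝ → ℝ} {ε : ℝ} (hα : 0 < α)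
    (hF : LocallyFiniteMass F α) (hxy : x ≤ y)
    (hf : ∀ p ∈ Set.Icc x y, ∀ q ∈ Set.Icc x y, f p ≤ f q + ε) :
    sSup (f '' (F ∩ Set.Icc x y)) * (staircase F α l y - staircase F α l x) ≤
      sInf (f '' (F ∩ Set.Icc x y)) * (staircase F α l y - staircase F α l x) +
        ε * (staircase F α l y - staircase F α l x) := by
  rcases (monotone_staircase (l := l) hα hF hxy).eq_or_lt with h | h
  · simp [h]
  have hne := (inter_Icc_nonempty_of_staircase_lt hα hF hxy h).image f
  rw [← add_mul]
  refine mul_le_mul_of_nonneg_right (csSup_le hne ?_) (sub_pos.2 h).le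
  rintro _ ⟨p, hp, rfl⟩
  rw [← sub_le_iff_le_add]
  refine le_csInf hne ?_
  rintro _ ⟨q, hq, rfl⟩
  exact sub_le_iff_le_add.2 (hf p hp.2 q hq.2)

theorem exists_upperSum_le_lowerSum_add {f : ℝ → ℝ} (hα : 0 < α) (hF : LocallyFiniteMass F α)
    (hf : Continuous f) (hxy : x ≤ y) {ε : ℝ} (hε : 0 < ε) :
    ∃ P : Subdivision x y, P.upperSum F α l f ≤ P.lowerSum F α l f + ε := by
  obtain ⟨η, hη, hηε⟩ : ∃ η > 0, η * (staircase F α l y - staircase F α l x) ≤ ε := by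
    obtain ⟨η, hη, hlt⟩ := exists_pos_mul_lt hε (staircase F α l y - staircase F α l x)
    exact ⟨η, hη, (mul_comm _ _).trans_le hlt.le⟩
  obtain ⟨δ, hδ, hosc⟩ := Metric.uniformContinuousOn_iff_le.1
    (isCompact_Icc.uniformContinuousOn_of_continuous (hf.continuousOn (s := Set.Icc x y))) η hη
  obtain ⟨P, hP⟩ := Subdivision.exists_meshLE hxy hδ
  have htel : P.sum (fun s t => η * (staircase F α l t - staircase F α l s)) =
      η * (staircase F α l y - staircase F α l x) := by
    rw [mul_sub, ← P.sum_sub fun t => η * staircase F α l t]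
    simp only [mul_sub]
  refine ⟨P, le_trans ?_ (add_le_add_right (htel.trans_le hηε) _)⟩
  rw [Subdivision.upperSum, Subdivision.lowerSum, Subdivision.sum, ← Finset.sum_add_distrib]
  refine Finset.sum_le_sum fun i hi => ?_
  have hi := Finset.mem_range.1 hi
  refine sSup_image_mul_le_sInf_image_mul_add hα hF (P.lt_succ i hi).le fun p hp q hq => ?_
  have hdist := hosc p (P.Icc_pt_subset hi hp) q (P.Icc_pt_subset hi hq)
    ((Real.dist_le_of_mem_Icc hp hq).trans (hP i hi))
  linarith [(abs_le.1 (Real.dist_eq .. ▸ hdist)).2]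

theorem Subdivision.sum_integral (P : Subdivision x y) (hg : Continuous g) (S : ℝ → ℝ) :
    P.sum (fun s t => ∫ u in S s..S t, g u) = ∫ u in S x..S y, g u := by
  rw [Subdivision.sum, intervalIntegral.sum_integral_adjacent_intervals (a := fun i => S (P.pt i))
    (fun i _ => hg.intervalIntegrable _ _), P.pt_zero, P.pt_last]

theorem hasFractalIntegral_comp_staircase (hα : 0 < α) (hF : LocallyFiniteMass F α)
    (hg : Continuous g) (hxy : x ≤ y) :
    HasFractalIntegral F α l (fun t => g (staircase F α l t)) x y
      (∫ u in staircase F α l x..staircase F α l y, g u) := by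
  have hlower (P : Subdivision x y) : P.lowerSum F α l (fun t => g (staircase F α l t)) ≤
      ∫ u in staircase F α l x..staircase F α l y, g u := by
    rw [← P.sum_integral hg]
    exact Finset.sum_le_sum fun i hi =>
      sInf_image_mul_le_integral hα hF hg (P.lt_succ i (Finset.mem_range.1 hi)).le
  have hupper (P : Subdivision x y) : ∫ u in staircase F α l x..staircase F α l y, g u ≤
      P.upperSum F α l (fun t => g (staircase F α l t)) := by
    rw [← P.sum_integral hg]
    exact Finset.sum_le_sum fun i hi =>
      integral_le_sSup_image_mul hα hF hg (P.lt_succ i (Finset.mem_range.1 hi)).le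
  have hgap {ε : ℝ} (hε : 0 < ε) := exists_upperSum_le_lowerSum_add (l := l) hα hF
    (hg.comp (continuous_staircase (l := l) hα hF)) hxy hε
  refine ⟨bddAbove_image_comp_staircase hα hF hg x y, bddBelow_image_comp_staircase hα hF hg x y,
    ⟨?_, fun M hM => ?_⟩, ⟨?_, fun M hM => ?_⟩⟩
  · rintro _ ⟨P, rfl⟩
    exact hlower P
  · refine le_of_forall_pos_le_add fun ε hε => ?_
    obtain ⟨P, hP⟩ := hgap hε
    exact (hupper P).trans (hP.trans (add_le_add_left (hM ⟨P, rfl⟩) ε))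
  · rintro _ ⟨P, rfl⟩
    exact hupper P
  · refine le_of_forall_pos_le_add fun ε hε => ?_
    obtain ⟨P, hP⟩ := hgap hε
    exact (hM ⟨P, rfl⟩).trans (hP.trans (add_le_add_left (hlower P) ε))

theorem HasFractalIntegral.unique {f : ℝ → ℝ} {I J : ℝ} (hI : HasFractalIntegral F α l f x y I)
    (hJ : HasFractalIntegral F α l f x y J) : I = J :=
  hI.2.2.1.unique hJ.2.2.1

theorem HasFractalImproperIntegral.unique {f : ℝ → ℝ} {I J : ℝ}
    (hI : HasFractalImproperIntegral F α l f I) (hJ : HasFractalImproperIntegral F α l f J) :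
    I = J := by
  obtain ⟨G, hG, hGI⟩ := hI
  obtain ⟨H, hH, hHJ⟩ := hJ
  refine tendsto_nhds_unique (hGI.congr' ?_) hHJ
  filter_upwards [eventually_ge_atTop 0] with b hb using (hG b hb).unique (hH b hb)

theorem HasFractalImproperIntegral.fractalImproperIntegral_eq {f : ℝ → ℝ} {I : ℝ}
    (hI : HasFractalImproperIntegral F α l f I) : fractalImproperIntegral F α l f = I := by
  have hex : ∃ I, HasFractalImproperIntegral F α l f I := ⟨I, hI⟩
  rw [fractalImproperIntegral, dif_pos hex]
  exact hex.choose_spec.unique hI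

end Integral

/-! ### Improper integrals -/

section Improper

open MeasureTheory

variable {f g : ℝ → ℝ} {I J : ℝ}

/-- The improper, possibly only conditionally convergent, integral `∫_0^∞ f` exists and
equals `I`. -/
def HasImproperIntegral (f : ℝ → ℝ) (I : ℝ) : Prop :=
  Tendsto (fun X => ∫ x in (0 : ℝ)..X, f x) atTop (𝓝 I)

theorem HasImproperIntegral.unique (hI : HasImproperIntegral f I) (hJ : HasImproperIntegral f J) :
    I = J :=
  tendsto_nhds_unique hI hJ

theorem hasImproperIntegral_congr (hfg : ∀ x, 0 ≤ x → f x = g x) :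
    HasImproperIntegral f I ↔ HasImproperIntegral g I := by
  refine tendsto_congr' ?_
  filter_upwards [eventually_ge_atTop 0] with X hX
  refine intervalIntegral.integral_congr fun x hx => hfg x ?_
  rw [Set.uIcc_of_le hX] at hx
  exact hx.1

theorem HasImproperIntegral.const_mul (hI : HasImproperIntegral f I) (c : ℝ) :
    HasImproperIntegral (fun x => c * f x) (c * I) := by
  simpa only [HasImproperIntegral, intervalIntegral.integral_const_mul] using
    Tendsto.const_mul c hI

theorem HasImproperIntegral.sub (hf : ∀ X, IntervalIntegrable f volume 0 X)
    (hg : ∀ X, IntervalIntegrable g volume 0 X) (hI : HasImproperIntegral f I)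
    (hJ : HasImproperIntegral g J) : HasImproperIntegral (fun x => f x - g x) (I - J) := by
  simpa only [HasImproperIntegral, intervalIntegral.integral_sub (hf _) (hg _)] using
    Tendsto.sub hI hJ

theorem hasImproperIntegral_of_integrableOn (hf : IntegrableOn f (Set.Ioi 0)) :
    HasImproperIntegral f (∫ x in Set.Ioi 0, f x) :=
  intervalIntegral_tendsto_integral_Ioi 0 hf tendsto_id

theorem hasImproperIntegral_exp_neg : HasImproperIntegral (fun x => Real.exp (-x)) 1 := by
  simpa only [integral_exp_neg_Ioi_zero] using
    hasImproperIntegral_of_integrableOn (integrableOn_exp_neg_Ioi 0)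

theorem map_atTop_eq_of_continuous {φ : ℝ → ℝ} (hφ : Continuous φ)
    (htop : Tendsto φ atTop atTop) : map φ atTop = atTop := by
  refine le_antisymm htop fun s hs => ?_
  obtain ⟨N, hN⟩ := mem_atTop_sets.1 (mem_map.1 hs)
  refine mem_of_superset (Ici_mem_atTop (φ N)) fun y hy => ?_
  obtain ⟨x, hx, rfl⟩ := isPreconnected_Ici.intermediate_value_Ici (Set.self_mem_Ici (a := N))
    (le_principal_iff.2 (Ici_mem_atTop N)) hφ.continuousOn htop hy
  exact hN x hx

theorem hasImproperIntegral_comp_mul_left {w : ℝ} (hw : 0 < w) :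
    HasImproperIntegral (fun x => f (w * x)) I ↔ HasImproperIntegral f (w * I) := by
  have hmap : map (fun X : ℝ => w * X) atTop = atTop :=
    map_atTop_eq_of_continuous (continuous_const_mul w) (tendsto_id.const_mul_atTop hw)
  have hsubst : HasImproperIntegral f (w * I) ↔
      Tendsto (fun X => w * ∫ x in (0 : ℝ)..X, f (w * x)) atTop (𝓝 (w * I)) := by
    simp only [intervalIntegral.mul_integral_comp_mul_left, mul_zero]
    conv_lhs => rw [HasImproperIntegral, ← hmap, tendsto_map'_iff]
    rfl
  rw [hsubst]
  refine ⟨fun hI => Tendsto.const_mul w hI, fun hI => ?_⟩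
  simpa only [HasImproperIntegral, inv_mul_cancel_left₀ hw.ne'] using hI.const_mul w⁻¹

end Improper

section StaircaseSubstitution

variable {F : Set ℝ} {α l : ℝ} {g : ℝ → ℝ}

theorem hasFractalImproperIntegral_comp_staircase_iff (hα : 0 < α) (hF : LocallyFiniteMass F α)
    (hzero : staircase F α l 0 = 0) (htop : Tendsto (staircase F α l) atTop atTop)
    (hg : Continuous g) {I : ℝ} :
    HasFractalImproperIntegral F α l (fun t => g (staircase F α l t)) I ↔
      HasImproperIntegral g I := by
  have hInt {b : ℝ} (hb : 0 ≤ b) : HasFractalIntegral F α l (fun t => g (staircase F α l t)) 0 b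
      (∫ u in (0 : ℝ)..staircase F α l b, g u) := by
    simpa only [hzero] using hasFractalIntegral_comp_staircase (l := l) hα hF hg hb
  rw [HasImproperIntegral, ← map_atTop_eq_of_continuous (continuous_staircase hα hF) htop,
    tendsto_map'_iff]
  refine ⟨fun ⟨G, hG, hGI⟩ => hGI.congr' ?_, fun hI => ⟨_, fun b => hInt, hI⟩⟩
  filter_upwards [eventually_ge_atTop 0] with b hb using (hG b hb).unique (hInt hb)

theorem fractalGamma_eq_Gamma (hα : 0 < α) (hF : LocallyFiniteMass F α)
    (hzero : staircase F α l 0 = 0) (htop : Tendsto (staircase F α l) atTop atTop) {s : ℝ}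
    (hs : 1 ≤ s) : fractalGamma F α l s = Real.Gamma s := by
  have hcont : Continuous fun u : ℝ => Real.exp (-u) * u ^ (s - 1) :=
    (Real.continuous_exp.comp continuous_neg).mul
      (Real.continuous_rpow_const (sub_nonneg.2 hs))
  refine HasFractalImproperIntegral.fractalImproperIntegral_eq
    ((hasFractalImproperIntegral_comp_staircase_iff hα hF hzero htop hcont).2 ?_)
  rw [Real.Gamma_eq_integral (by linarith)]
  exact hasImproperIntegral_of_integrableOn (Real.GammaIntegral_convergent (by linarith))

theorem hasFractalSumudu_comp_staircase_iff (hα : 0 < α) (hF : LocallyFiniteMass F α)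
    (hzero : staircase F α l 0 = 0) (htop : Tendsto (staircase F α l) atTop atTop)
    (hg : Continuous g) {v c : ℝ} (hv : 0 < staircase F α l v) :
    HasFractalSumudu F α l (fun t => g (staircase F α l t)) v c ↔
      HasImproperIntegral (fun x => Real.exp (-x) * g (staircase F α l v * x)) c := by
  set w := staircase F α l v
  have hcont : Continuous fun u => Real.exp (-(u / w)) * g u := by fun_prop
  have hscale : (fun x => Real.exp (-x) * g (w * x)) =
      fun x => Real.exp (-(w * x / w)) * g (w * x) := by
    funext x
    rw [mul_div_cancel_left₀ x hv.ne']
  rw [hscale, hasImproperIntegral_comp_mul_left (f := fun u => Real.exp (-(u / w)) * g u) hv,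
    ← hasFractalImproperIntegral_comp_staircase_iff hα hF hzero htop hcont]
  refine ⟨?_, fun hI => ⟨w * c, hI, ?_⟩⟩
  · rintro ⟨I, hI, rfl⟩
    rwa [one_div, mul_inv_cancel_left₀ hv.ne']
  · rw [one_div, inv_mul_cancel_left₀ hv.ne']

end StaircaseSubstitution

/-! ### Convolutions on the half-line -/

section Convolution

open MeasureTheory

variable {k h f y : ℝ → ℝ} {T X x : ℝ}

/-- The convolution `(k ∗ h)(x) = ∫_0^x k(x - s) h(s) ds` of functions on the half-line, for
`x ≥ 0`. -/
noncomputable def halfLineConv (k h : ℝ → ℝ) (x : ℝ) : ℝ :=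
  ∫ s in (0 : ℝ)..x, k (x - s) * h s

theorem halfLineConv_comm (k h : ℝ → ℝ) (x : ℝ) : halfLineConv k h x = halfLineConv h k x := by
  simpa [halfLineConv, mul_comm] using
    (intervalIntegral.integral_comp_sub_left (a := 0) (b := x) (fun s => k (x - s) * h s) x).symm

theorem integral_Ioc_indicator_comp_sub {r : ℝ} (hr : r ∈ Set.Ioc 0 X) :
    ∫ x in Set.Ioc 0 X, (Set.Ioc 0 X).indicator h (x - r) = ∫ s in (0 : ℝ)..X - r, h s := by
  have hX : 0 ≤ X := hr.1.le.trans hr.2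
  rw [← intervalIntegral.integral_of_le hX,
    intervalIntegral.integral_comp_sub_right ((Set.Ioc 0 X).indicator h),
    intervalIntegral.integral_of_le (by linarith), setIntegral_indicator measurableSet_Ioc,
    Set.Ioc_inter_Ioc, max_eq_right (by linarith [hr.1]), min_eq_left (by linarith [hr.1]),
    intervalIntegral.integral_of_le (by linarith [hr.2])]

theorem integral_indicator_mul_indicator_comp_sub (hx : x ∈ Set.Ioc 0 X) :
    ∫ r, (Set.Ioc 0 X).indicator k r * (Set.Ioc 0 X).indicator h (x - r) =
      halfLineConv k h x := by
  have hind (r : ℝ) : (Set.Ioc 0 X).indicator k r * (Set.Ioc 0 X).indicator h (x - r) =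
      (Set.Ioo 0 x).indicator (fun r => h (x - r) * k r) r := by
    by_cases hr : r ∈ Set.Ioo 0 x
    · have hrX : r ∈ Set.Ioc 0 X := ⟨hr.1, hr.2.le.trans hx.2⟩
      have hxr : x - r ∈ Set.Ioc 0 X := ⟨sub_pos.2 hr.2, by linarith [hr.1, hx.2]⟩
      rw [Set.indicator_of_mem hr, Set.indicator_of_mem hrX, Set.indicator_of_mem hxr, mul_comm]
    · rw [Set.indicator_of_notMem hr]
      by_cases hr₀ : 0 < r
      · have hxr : x - r ∉ Set.Ioc 0 X := fun hmem => hr ⟨hr₀, sub_pos.1 hmem.1⟩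
        rw [Set.indicator_of_notMem hxr, mul_zero]
      · have hr' : r ∉ Set.Ioc 0 X := fun hmem => hr₀ hmem.1
        rw [Set.indicator_of_notMem hr', zero_mul]
  simp only [hind]
  rw [integral_indicator measurableSet_Ioo, ← integral_Ioc_eq_integral_Ioo,
    ← intervalIntegral.integral_of_le hx.1.le, halfLineConv_comm, halfLineConv]

theorem integral_halfLineConv (hX : 0 ≤ X) (hk : IntervalIntegrable k volume 0 X)
    (hh : IntervalIntegrable h volume 0 X) :
    ∫ x in (0 : ℝ)..X, halfLineConv k h x =
      ∫ r in (0 : ℝ)..X, k r * ∫ s in (0 : ℝ)..X - r, h s := by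
  set K := (Set.Ioc 0 X).indicator k
  set H := (Set.Ioc 0 X).indicator h
  have hK : Integrable K := (integrable_indicator_iff measurableSet_Ioc).2
    ((intervalIntegrable_iff_integrableOn_Ioc_of_le hX).1 hk)
  have hH : Integrable H := (integrable_indicator_iff measurableSet_Ioc).2
    ((intervalIntegrable_iff_integrableOn_Ioc_of_le hX).1 hh)
  have hprod : Integrable (fun p : ℝ × ℝ => K p.2 * H (p.1 - p.2))
      ((volume.restrict (Set.Ioc 0 X)).prod volume) := by
    simpa [IntegrableOn, ← Measure.prod_restrict, Measure.restrict_univ] using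
      (hK.convolution_integrand (ContinuousLinearMap.mul ℝ ℝ) hH).integrableOn
        (s := Set.Ioc 0 X ×ˢ Set.univ)
  calc ∫ x in (0 : ℝ)..X, halfLineConv k h x
      = ∫ x in Set.Ioc 0 X, ∫ r, K r * H (x - r) := by
        rw [intervalIntegral.integral_of_le hX]
        exact setIntegral_congr_fun measurableSet_Ioc
          fun x hx => (integral_indicator_mul_indicator_comp_sub hx).symm
    _ = ∫ r, ∫ x in Set.Ioc 0 X, K r * H (x - r) := integral_integral_swap hprod
    _ = ∫ r, (Set.Ioc 0 X).indicator (fun r => k r * ∫ s in (0 : ℝ)..X - r, h s) r := by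
        congr with r
        rw [integral_const_mul]
        by_cases hr : r ∈ Set.Ioc 0 X
        · rw [integral_Ioc_indicator_comp_sub hr]
          simp only [K, Set.indicator_of_mem hr]
        · simp only [K, Set.indicator_of_notMem hr, zero_mul]
    _ = ∫ r in (0 : ℝ)..X, k r * ∫ s in (0 : ℝ)..X - r, h s := by
        rw [integral_indicator measurableSet_Ioc, intervalIntegral.integral_of_le hX]

theorem exists_forall_nonneg_norm_le {Y : ℝ → ℝ} {I : ℝ} (hY : Continuous Y)
    (hI : Tendsto Y atTop (𝓝 I)) : ∃ C, ∀ t, 0 ≤ t → ‖Y t‖ ≤ C := by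
  obtain ⟨N, hN⟩ := eventually_atTop.1 (hI.norm.eventually_lt_const (lt_add_one ‖I‖))
  obtain ⟨C, hC⟩ := (isCompact_Icc (a := (0 : ℝ)) (b := N)).exists_bound_of_continuousOn
    hY.continuousOn
  refine ⟨max C (‖I‖ + 1), fun t ht => ?_⟩
  rcases le_total t N with h | h
  · exact (hC t ⟨ht, h⟩).trans (le_max_left _ _)
  · exact (hN t h).le.trans (le_max_right _ _)

theorem tendsto_integral_mul_comp_sub {Y : ℝ → ℝ} {I : ℝ} (hk : IntegrableOn k (Set.Ioi 0))
    (hY : Continuous Y) (hI : Tendsto Y atTop (𝓝 I)) :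
    Tendsto (fun X => ∫ r in (0 : ℝ)..X, k r * Y (X - r)) atTop
      (𝓝 ((∫ r in Set.Ioi 0, k r) * I)) := by
  obtain ⟨C, hC⟩ := exists_forall_nonneg_norm_le hY hI
  have hind : (fun X => ∫ r in (0 : ℝ)..X, k r * Y (X - r)) =ᶠ[atTop]
      fun X => ∫ r in Set.Ioi 0, (Set.Iic X).indicator (fun r => k r * Y (X - r)) r := by
    filter_upwards [eventually_ge_atTop 0] with X hX
    rw [setIntegral_indicator measurableSet_Iic, Set.Ioi_inter_Iic,
      intervalIntegral.integral_of_le hX]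
  rw [tendsto_congr' hind, ← integral_mul_const]
  refine tendsto_integral_filter_of_dominated_convergence (fun r => ‖k r‖ * C) ?_ ?_
    (hk.norm.mul_const C) ?_
  · refine Eventually.of_forall fun X => AEStronglyMeasurable.indicator ?_ measurableSet_Iic
    exact hk.aestronglyMeasurable.mul (by fun_prop)
  · refine Eventually.of_forall fun X => Eventually.of_forall fun r => ?_
    by_cases hr : r ≤ X
    · rw [Set.indicator_of_mem (Set.mem_Iic.2 hr), norm_mul]
      exact mul_le_mul_of_nonneg_left (hC _ (sub_nonneg.2 hr)) (norm_nonneg _)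
    · rw [Set.indicator_of_notMem (by simpa using hr), norm_zero]
      exact mul_nonneg (norm_nonneg _) ((norm_nonneg _).trans (hC 0 le_rfl))
  · refine Eventually.of_forall fun r => ?_
    have hlim : Tendsto (fun X => k r * Y (X - r)) atTop (𝓝 (k r * I)) :=
      (hI.comp (tendsto_atTop_add_const_right _ (-r) tendsto_id)).const_mul _
    refine hlim.congr' ?_
    filter_upwards [eventually_ge_atTop r] with X hX
    rw [Set.indicator_of_mem (Set.mem_Iic.2 hX)]

theorem HasImproperIntegral.halfLineConv {I : ℝ} (hk : IntegrableOn k (Set.Ioi 0))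
    (hh : ∀ a b, IntervalIntegrable h volume a b) (hI : HasImproperIntegral h I) :
    HasImproperIntegral (halfLineConv k h) ((∫ r in Set.Ioi 0, k r) * I) := by
  have hlim := tendsto_integral_mul_comp_sub hk (intervalIntegral.continuous_primitive hh 0) hI
  refine hlim.congr' ?_
  filter_upwards [eventually_ge_atTop 0] with X hX
  have hkX : IntervalIntegrable k volume 0 X :=
    (intervalIntegrable_iff_integrableOn_Ioc_of_le hX).2 (hk.mono_set Set.Ioc_subset_Ioi_self)
  exact (integral_halfLineConv hX hkX (hh 0 X)).symm

end Convolution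

/-! ### Positive solutions of Volterra equations -/

section Volterra

open MeasureTheory

variable {k f y : ℝ → ℝ} {T x : ℝ}

theorem exists_first_nonpos (hy : Continuous y) (hy₀ : 0 < y 0) (hx : 0 ≤ x) (hyx : y x ≤ 0) :
    ∃ T > 0, y T ≤ 0 ∧ ∀ t, 0 ≤ t → t < T → 0 < y t := by
  have hclosed : IsClosed (Set.Ici 0 ∩ y ⁻¹' Set.Iic 0) :=
    isClosed_Ici.inter (isClosed_Iic.preimage hy)
  have hbdd : BddBelow (Set.Ici 0 ∩ y ⁻¹' Set.Iic 0) := ⟨0, fun t ht => ht.1⟩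
  obtain ⟨hT₀, hyT⟩ := hclosed.csInf_mem ⟨x, hx, hyx⟩ hbdd
  refine ⟨_, lt_of_le_of_ne hT₀ fun heq => ?_, hyT, fun t ht htT => ?_⟩
  · rw [Set.mem_preimage, ← heq] at hyT
    exact hy₀.not_ge hyT
  · by_contra! hyt
    exact htT.not_ge (csInf_le hbdd ⟨ht, hyt⟩)

theorem intervalIntegrable_comp_sub_mul (hk : ∀ a b, IntervalIntegrable k volume a b)
    (hy : Continuous y) (T a b : ℝ) :
    IntervalIntegrable (fun s => k (T - s) * y s) volume a b := by
  refine IntervalIntegrable.mul_continuousOn ?_ hy.continuousOn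
  simpa only [sub_sub_cancel] using (hk (T - a) (T - b)).comp_sub_left T

theorem volterra_le_integral_tail (hk : ∀ a b, IntervalIntegrable k volume a b)
    (hkanti : AntitoneOn k (Set.Ioi 0)) (hf : MonotoneOn f (Set.Ici 0)) (hy : Continuous y)
    (heq : ∀ x, 0 ≤ x → y x = f x - halfLineConv k y x) (hyT : y T ≤ 0)
    (hpos : ∀ t, 0 ≤ t → t < T → 0 < y t) {t : ℝ} (ht : 0 ≤ t) (htT : t < T) :
    y t ≤ ∫ s in t..T, k (T - s) * y s := by
  have hInt := intervalIntegrable_comp_sub_mul hk hy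
  have hle : ∫ s in (0 : ℝ)..t, k (T - s) * y s ≤ ∫ s in (0 : ℝ)..t, k (t - s) * y s := by
    refine intervalIntegral.integral_mono_on_of_le_Ioo ht (hInt T 0 t) (hInt t 0 t)
      fun s hs => mul_le_mul_of_nonneg_right ?_ (hpos s hs.1.le (hs.2.trans htT)).le
    exact hkanti (sub_pos.2 hs.2) (sub_pos.2 (hs.2.trans htT)) (by linarith)
  have hT := heq T (ht.trans htT.le)
  rw [halfLineConv, ← intervalIntegral.integral_add_adjacent_intervals (hInt T 0 t) (hInt T t T)]
    at hT
  have hyt := heq t ht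
  rw [halfLineConv] at hyt
  linarith [hf ht (ht.trans htT.le) htT.le]

/-- If `T` were the first zero of `y`, then `y t ≤ ∫_t^T k(T - s) y(s) ds` for all `t < T`, which
fails where `y` attains its maximum on an interval `[T - δ, T]` with `∫_0^δ k < 1`. -/
theorem volterra_pos (hk : ∀ a b, IntervalIntegrable k volume a b)
    (hkanti : AntitoneOn k (Set.Ioi 0)) (hk₀ : ∀ r, 0 ≤ r → 0 ≤ k r)
    (hf : MonotoneOn f (Set.Ici 0)) (hf₀ : 0 < f 0) (hy : Continuous y)
    (heq : ∀ x, 0 ≤ x → y x = f x - halfLineConv k y x) (hx : 0 ≤ x) : 0 < y x := by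
  by_contra! hyx
  have hy₀ : 0 < y 0 := by simpa [halfLineConv, heq 0 le_rfl] using hf₀
  obtain ⟨T, hT, hyT, hpos⟩ := exists_first_nonpos hy hy₀ hx hyx
  obtain ⟨δ, hδ, hδ₀, hδT⟩ : ∃ δ, ∫ r in (0 : ℝ)..δ, k r < 1 ∧ δ ∈ Set.Ioo 0 T := by
    have hprim := (intervalIntegral.continuous_primitive hk 0).tendsto 0
    rw [intervalIntegral.integral_same] at hprim
    exact (((hprim.mono_left nhdsWithin_le_nhds).eventually_lt_const one_pos).and
      (Ioo_mem_nhdsGT hT)).exists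
  obtain ⟨t, ⟨htl, htr⟩, htmax⟩ := isCompact_Icc.exists_isMaxOn
    (Set.nonempty_Icc.2 (by linarith : T - δ ≤ T)) hy.continuousOn
  have hyt : 0 < y t := (hpos (T - δ) (by linarith) (by linarith)).trans_le
    (htmax (Set.left_mem_Icc.2 (by linarith)))
  have htT : t < T := lt_of_le_of_ne htr fun h => (h ▸ hyt).not_ge hyT
  refine lt_irrefl (y t) ?_
  calc y t ≤ ∫ s in t..T, k (T - s) * y s :=
        volterra_le_integral_tail hk hkanti hf hy heq hyT hpos (by linarith) htT
    _ ≤ ∫ s in t..T, k (T - s) * y t := by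
        refine intervalIntegral.integral_mono_on htT.le
          (intervalIntegrable_comp_sub_mul hk hy T t T)
          (intervalIntegrable_comp_sub_mul hk continuous_const T t T) fun s hs => ?_
        exact mul_le_mul_of_nonneg_left (htmax ⟨htl.trans hs.1, hs.2⟩) (hk₀ _ (sub_nonneg.2 hs.2))
    _ = (∫ r in (0 : ℝ)..T - t, k r) * y t := by
        rw [intervalIntegral.integral_mul_const, intervalIntegral.integral_comp_sub_left k,
          sub_self]
    _ ≤ (∫ r in (0 : ℝ)..δ, k r) * y t := by
        refine mul_le_mul_of_nonneg_right ?_ hyt.le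
        refine intervalIntegral.integral_mono_interval le_rfl (by linarith) (by linarith) ?_
          (hk 0 δ)
        exact (ae_restrict_mem measurableSet_Ioc).mono fun r hr => hk₀ r hr.1.le
    _ < y t := mul_lt_of_lt_one_left hyt hδ

end Volterra

/-! ### The Mittag-Leffler function -/

section MittagLeffler

open MeasureTheory

variable {p q β x : ℝ}

/-- The Riemann–Liouville kernel: convolution with `powerKernel β` on the half-line is the
fractional integral of order `β`. -/
noncomputable def powerKernel (β r : ℝ) : ℝ :=
  r ^ (β - 1) / Real.Gamma β

theorem powerKernel_nonneg (hβ : 0 < β) (hx : 0 ≤ x) : 0 ≤ powerKernel β x :=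
  div_nonneg (Real.rpow_nonneg hx _) (Real.Gamma_pos_of_pos hβ).le

theorem intervalIntegrable_powerKernel (hβ : 0 < β) (a b : ℝ) :
    IntervalIntegrable (powerKernel β) volume a b :=
  (intervalIntegral.intervalIntegrable_rpow' (by linarith)).div_const _

theorem antitoneOn_powerKernel (hβ : 0 < β) (hβ₁ : β ≤ 1) :
    AntitoneOn (powerKernel β) (Set.Ioi 0) := fun _ hr _ _ hrs =>
  div_le_div_of_nonneg_right (Real.rpow_le_rpow_of_nonpos hr hrs (by linarith))
    (Real.Gamma_pos_of_pos hβ).le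

theorem monotoneOn_powerKernel (hβ : 1 ≤ β) : MonotoneOn (powerKernel β) (Set.Ici 0) :=
  fun _ hr _ _ hrs => div_le_div_of_nonneg_right (Real.rpow_le_rpow hr hrs (by linarith))
    (Real.Gamma_pos_of_pos (by linarith)).le

theorem integral_sub_rpow_mul_rpow (hp : 0 < p) (hq : 0 < q) (hx : 0 < x) :
    ∫ s in (0 : ℝ)..x, (x - s) ^ (p - 1) * s ^ (q - 1) =
      x ^ (p + q - 1) * (Real.Gamma p * Real.Gamma q / Real.Gamma (p + q)) := by
  have hbeta := Complex.betaIntegral_scaled q p hx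
  rw [Complex.betaIntegral_eq_Gamma_mul_div _ _ (by simpa) (by simpa)] at hbeta
  rw [← Complex.ofReal_inj, ← intervalIntegral.integral_ofReal]
  calc ∫ s in (0 : ℝ)..x, (((x - s) ^ (p - 1) * s ^ (q - 1) : ℝ) : ℂ)
      = ∫ s in (0 : ℝ)..x, (s : ℂ) ^ ((q : ℂ) - 1) * ((x : ℂ) - s) ^ ((p : ℂ) - 1) := by
        refine intervalIntegral.integral_congr fun s hs => ?_
        rw [Set.uIcc_of_le hx.le] at hs
        rw [mul_comm]
        push_cast [Complex.ofReal_cpow hs.1, Complex.ofReal_cpow (sub_nonneg.2 hs.2)]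
        rfl
    _ = _ := by
        rw [hbeta]
        push_cast [Complex.ofReal_cpow hx.le, ← Complex.Gamma_ofReal]
        rw [add_comm (p : ℂ), mul_comm (Complex.Gamma p)]

theorem halfLineConv_powerKernel_powerKernel (hp : 0 < p) (hq : 0 < q) (hx : 0 < x) :
    halfLineConv (powerKernel p) (powerKernel q) x = powerKernel (p + q) x := by
  have hΓp := (Real.Gamma_pos_of_pos hp).ne'
  have hΓq := (Real.Gamma_pos_of_pos hq).ne'
  simp only [halfLineConv, powerKernel, div_mul_div_comm]
  rw [intervalIntegral.integral_div, integral_sub_rpow_mul_rpow hp hq hx]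
  field_simp

theorem hasSum_halfLineConv {F : ℕ → ℝ → ℝ} {M : ℕ → ℝ} {k f : ℝ → ℝ} (hx : 0 ≤ x)
    (hk : IntervalIntegrable k volume 0 x) (hF : ∀ j, Measurable (F j))
    (hFM : ∀ j, ∀ s ∈ Set.Ioc 0 x, |F j s| ≤ M j) (hM : Summable M)
    (hf : ∀ s ∈ Set.Ioc 0 x, HasSum (fun j => F j s) (f s)) :
    HasSum (fun j => halfLineConv k (F j) x) (halfLineConv k f x) := by
  have hkx : IntervalIntegrable (fun s => k (x - s)) volume 0 x := by
    simpa only [sub_zero, sub_self] using (hk.comp_sub_left x).symm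
  refine intervalIntegral.hasSum_integral_of_dominated_convergence
    (fun j s => ‖k (x - s)‖ * M j) (fun j => ?_) (fun j => ?_) ?_ ?_ ?_
  · rw [Set.uIoc_of_le hx]
    exact hkx.1.aestronglyMeasurable.mul (hF j).aestronglyMeasurable
  · refine Eventually.of_forall fun s hs => ?_
    rw [Set.uIoc_of_le hx] at hs
    rw [norm_mul]
    exact mul_le_mul_of_nonneg_left (hFM j s hs) (norm_nonneg _)
  · exact Eventually.of_forall fun s _ => hM.mul_left _
  · simpa only [tsum_mul_left] using hkx.norm.mul_const _
  · refine Eventually.of_forall fun s hs => ?_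
    rw [Set.uIoc_of_le hx] at hs
    exact (hf s hs).mul_left _

theorem rpow_mul_exp_neg_le_Gamma {A s : ℝ} (hA : 0 < A) (hs : 1 ≤ s) :
    A ^ (s - 1) * Real.exp (-A) ≤ Real.Gamma s := by
  have hconv := Real.GammaIntegral_convergent (by linarith : 0 < s)
  rw [Real.Gamma_eq_integral (by linarith), ← integral_exp_neg_Ioi, ← integral_const_mul]
  calc ∫ x in Set.Ioi A, A ^ (s - 1) * Real.exp (-x)
      ≤ ∫ x in Set.Ioi A, Real.exp (-x) * x ^ (s - 1) := by
        refine setIntegral_mono_on ((integrableOn_exp_neg_Ioi A).const_mul _)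
          (hconv.mono_set (Set.Ioi_subset_Ioi hA.le)) measurableSet_Ioi fun x hx => ?_
        rw [mul_comm]
        exact mul_le_mul_of_nonneg_left
          (Real.rpow_le_rpow hA.le (Set.mem_Ioi.1 hx).le (by linarith)) (Real.exp_pos _).le
    _ ≤ ∫ x in Set.Ioi 0, Real.exp (-x) * x ^ (s - 1) := by
        refine setIntegral_mono_set hconv ?_ (Set.Ioi_subset_Ioi hA.le).eventuallyLE
        filter_upwards [ae_restrict_mem measurableSet_Ioi] with x hx
        exact mul_nonneg (Real.exp_pos _).le (Real.rpow_nonneg (Set.mem_Ioi.1 hx).le _)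

theorem Gamma_mul_natCast_add_one_pos (hβ : 0 < β) (j : ℕ) : 0 < Real.Gamma (β * j + 1) :=
  Real.Gamma_pos_of_pos (by positivity)

/-- The classical Mittag-Leffler function `E_β(z) = ∑_j z^j / Γ(β j + 1)`. -/
noncomputable def mittagLeffler (β z : ℝ) : ℝ :=
  ∑' j : ℕ, z ^ j / Real.Gamma (β * j + 1)

theorem summable_mittagLeffler (hβ : 0 < β) (z : ℝ) :
    Summable fun j : ℕ => z ^ j / Real.Gamma (β * j + 1) := by
  obtain ⟨A, hAz, hA⟩ := (((tendsto_rpow_atTop hβ).eventually_gt_atTop |z|).and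
    (eventually_gt_atTop 0)).exists
  have hAβ : 0 < A ^ β := Real.rpow_pos_of_pos hA _
  have hgeo : Summable fun j : ℕ => Real.exp A * (|z| / A ^ β) ^ j :=
    (summable_geometric_of_lt_one (by positivity) ((div_lt_one hAβ).2 hAz)).mul_left _
  refine hgeo.of_norm_bounded fun j => ?_
  have hΓ : (A ^ β) ^ j * Real.exp (-A) ≤ Real.Gamma (β * j + 1) := by
    have hle := rpow_mul_exp_neg_le_Gamma hA (le_add_of_nonneg_left (by positivity : 0 ≤ β * j))
    rwa [add_sub_cancel_right, Real.rpow_mul hA.le, Real.rpow_natCast] at hle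
  rw [norm_div, norm_pow, Real.norm_eq_abs,
    Real.norm_of_nonneg (Gamma_mul_natCast_add_one_pos hβ j).le]
  calc |z| ^ j / Real.Gamma (β * j + 1) ≤ |z| ^ j / ((A ^ β) ^ j * Real.exp (-A)) := by gcongr
    _ = Real.exp A * (|z| / A ^ β) ^ j := by
        rw [Real.exp_neg, div_pow]
        field_simp

theorem continuous_mittagLeffler (hβ : 0 < β) : Continuous (mittagLeffler β) := by
  refine continuous_iff_continuousAt.2 fun z => ?_
  have hball : ContinuousOn (mittagLeffler β) (Metric.ball 0 (|z| + 1)) := by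
    refine continuousOn_tsum (fun j => by fun_prop) (summable_mittagLeffler hβ (|z| + 1))
      fun j w hw => ?_
    have hΓ := Gamma_mul_natCast_add_one_pos hβ j
    rw [mem_ball_zero_iff] at hw
    rw [norm_div, norm_pow, Real.norm_of_nonneg hΓ.le]
    gcongr
  exact hball.continuousAt (Metric.isOpen_ball.mem_nhds (by simp))

theorem continuous_mittagLeffler_mul_rpow (hβ : 0 < β) (c : ℝ) :
    Continuous fun x : ℝ => mittagLeffler β (c * x ^ β) :=
  (continuous_mittagLeffler hβ).comp (continuous_const.mul (Real.continuous_rpow_const hβ.le))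

theorem mittagLeffler_zero (β : ℝ) : mittagLeffler β 0 = 1 := by
  rw [mittagLeffler, tsum_eq_single 0 fun j hj => by simp [hj]]
  simp

theorem hasSum_mittagLeffler_mul_rpow (hβ : 0 < β) (c : ℝ) (hx : 0 ≤ x) :
    HasSum (fun j : ℕ => c ^ j * powerKernel (β * j + 1) x) (mittagLeffler β (c * x ^ β)) := by
  refine (summable_mittagLeffler hβ (c * x ^ β)).hasSum.congr_fun fun j => ?_
  rw [powerKernel, add_sub_cancel_right, Real.rpow_mul hx, Real.rpow_natCast, mul_pow,
    mul_div_assoc]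

theorem hasSum_halfLineConv_powerKernel_mittagLeffler (hβ : 0 < β) (c : ℝ) (hx : 0 < x) :
    HasSum (fun j : ℕ => c ^ j * powerKernel (β * (j + 1 : ℕ) + 1) x)
      (halfLineConv (powerKernel β) (fun s => mittagLeffler β (c * s ^ β)) x) := by
  have hterm (j : ℕ) :
      halfLineConv (powerKernel β) (fun s => c ^ j * powerKernel (β * j + 1) s) x =
        c ^ j * powerKernel (β * (j + 1 : ℕ) + 1) x := by
    rw [show β * (j + 1 : ℕ) + 1 = β + (β * j + 1) by push_cast; ring,
      ← halfLineConv_powerKernel_powerKernel hβ (by positivity) hx]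
    simp only [halfLineConv, mul_left_comm _ (c ^ j), intervalIntegral.integral_const_mul]
  simp only [← hterm]
  refine hasSum_halfLineConv (M := fun j => |c| ^ j * powerKernel (β * j + 1) x) hx.le
    (intervalIntegrable_powerKernel hβ 0 x) (fun j => ?_) (fun j s hs => ?_)
    (hasSum_mittagLeffler_mul_rpow hβ |c| hx.le).summable
    fun s hs => hasSum_mittagLeffler_mul_rpow hβ c hs.1.le
  · unfold powerKernel
    fun_prop
  · rw [abs_mul, abs_pow, abs_of_nonneg (powerKernel_nonneg (by positivity) hs.1.le)]
    exact mul_le_mul_of_nonneg_left (monotoneOn_powerKernel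
      (le_add_of_nonneg_left (by positivity)) hs.1.le hx.le hs.2) (by positivity)

theorem mittagLeffler_volterra (hβ : 0 < β) (c : ℝ) (hx : 0 ≤ x) :
    mittagLeffler β (c * x ^ β) =
      1 + c * halfLineConv (powerKernel β) (fun s => mittagLeffler β (c * s ^ β)) x := by
  rcases hx.eq_or_lt with rfl | hx
  · simp [halfLineConv, Real.zero_rpow hβ.ne', mittagLeffler_zero]
  · have htail := (hasSum_halfLineConv_powerKernel_mittagLeffler hβ c hx).mul_left c
    simp only [← mul_assoc, ← pow_succ'] at htail
    have hzero : c ^ 0 * powerKernel (β * (0 : ℕ) + 1) x = 1 := by simp [powerKernel]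
    rw [← hzero]
    exact (hasSum_mittagLeffler_mul_rpow hβ c hx.le).unique htail.zero_add

theorem mittagLeffler_mul_rpow_pos (hβ : 0 < β) (hβ₁ : β ≤ 1) {c : ℝ} (hc : c ≤ 0)
    (hx : 0 ≤ x) : 0 < mittagLeffler β (c * x ^ β) := by
  refine volterra_pos (k := fun r => -c * powerKernel β r) (f := fun _ => 1)
    (y := fun t => mittagLeffler β (c * t ^ β))
    (fun a b => (intervalIntegrable_powerKernel hβ a b).const_mul _)
    (fun r hr s hs hrs => mul_le_mul_of_nonneg_left
      (antitoneOn_powerKernel hβ hβ₁ hr hs hrs) (neg_nonneg.2 hc))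
    (fun r hr => mul_nonneg (neg_nonneg.2 hc) (powerKernel_nonneg hβ hr)) monotoneOn_const
    one_pos (continuous_mittagLeffler_mul_rpow hβ c) (fun t ht => ?_) hx
  rw [mittagLeffler_volterra hβ c ht]
  simp only [halfLineConv, mul_assoc, intervalIntegral.integral_const_mul]
  ring

theorem mittagLeffler_mul_rpow_le_one (hβ : 0 < β) (hβ₁ : β ≤ 1) {c : ℝ} (hc : c ≤ 0)
    (hx : 0 ≤ x) : mittagLeffler β (c * x ^ β) ≤ 1 := by
  rw [mittagLeffler_volterra hβ c hx, add_le_iff_nonpos_right]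
  refine mul_nonpos_of_nonpos_of_nonneg hc (intervalIntegral.integral_nonneg hx fun s hs => ?_)
  exact mul_nonneg (powerKernel_nonneg hβ (sub_nonneg.2 hs.2))
    (mittagLeffler_mul_rpow_pos hβ hβ₁ hc hs.1).le

end MittagLeffler

/-! ### The Laplace integral of the Mittag-Leffler function -/

section Laplace

open MeasureTheory

variable {β c x I : ℝ}

theorem integrable_of_summable_integral_norm {Ω ι : Type*} [MeasurableSpace Ω] {μ : Measure Ω}
    [Countable ι] {F : ι → Ω → ℝ} {f : Ω → ℝ} (hF : ∀ i, Integrable (F i) μ)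
    (hsum : Summable fun i => ∫ ω, ‖F i ω‖ ∂μ) (hf : AEStronglyMeasurable f μ)
    (hFf : ∀ᵐ ω ∂μ, HasSum (fun i => F i ω) (f ω)) : Integrable f μ := by
  refine ⟨hf, ?_⟩
  calc ∫⁻ ω, ‖f ω‖ₑ ∂μ
      ≤ ∫⁻ ω, ∑' i, ‖F i ω‖ₑ ∂μ := by
        refine lintegral_mono_ae (hFf.mono fun ω hω => ?_)
        exact hω.tsum_eq ▸ enorm_tsum_le_tsum_enorm
    _ = ∑' i, ∫⁻ ω, ‖F i ω‖ₑ ∂μ := lintegral_tsum fun i => (hF i).1.enorm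
    _ = ∑' i, ENNReal.ofReal (∫ ω, ‖F i ω‖ ∂μ) := by
        simp only [ofReal_integral_norm_eq_lintegral_enorm (hF _)]
    _ < ∞ := hsum.tsum_ofReal_lt_top

theorem integrableOn_exp_neg_mul_powerKernel (hβ : 0 < β) :
    IntegrableOn (fun r => Real.exp (-r) * powerKernel β r) (Set.Ioi 0) := by
  simpa only [powerKernel, mul_div_assoc, IntegrableOn] using
    (Real.GammaIntegral_convergent hβ).div_const (Real.Gamma β)

theorem integral_exp_neg_mul_powerKernel (hβ : 0 < β) :
    ∫ r in Set.Ioi 0, Real.exp (-r) * powerKernel β r = 1 := by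
  simp only [powerKernel, ← mul_div_assoc]
  rw [integral_div, ← Real.Gamma_eq_integral hβ, div_self (Real.Gamma_pos_of_pos hβ).ne']

theorem continuous_exp_neg_mul_mittagLeffler (hβ : 0 < β) (c : ℝ) :
    Continuous fun x : ℝ => Real.exp (-x) * mittagLeffler β (c * x ^ β) :=
  (Real.continuous_exp.comp continuous_neg).mul (continuous_mittagLeffler_mul_rpow hβ c)

theorem halfLineConv_exp_neg_mul (k h : ℝ → ℝ) (x : ℝ) :
    halfLineConv (fun r => Real.exp (-r) * k r) (fun s => Real.exp (-s) * h s) x =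
      Real.exp (-x) * halfLineConv k h x := by
  rw [halfLineConv, halfLineConv, ← intervalIntegral.integral_const_mul]
  refine intervalIntegral.integral_congr fun s _ => ?_
  rw [show -x = -(x - s) + -s by ring, Real.exp_add]
  ring

theorem one_sub_mul_eq_one_of_hasImproperIntegral_mittagLeffler (hβ : 0 < β)
    (hI : HasImproperIntegral (fun x => Real.exp (-x) * mittagLeffler β (c * x ^ β)) I) :
    (1 - c) * I = 1 := by
  have hInt := (continuous_exp_neg_mul_mittagLeffler hβ c).intervalIntegrable (μ := volume)
  have hconv := (hI.halfLineConv (integrableOn_exp_neg_mul_powerKernel hβ) hInt).const_mul c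
  rw [integral_exp_neg_mul_powerKernel hβ, one_mul] at hconv
  have hexp (X : ℝ) : IntervalIntegrable (fun x => Real.exp (-x)) volume 0 X :=
    (Real.continuous_exp.comp continuous_neg).intervalIntegrable 0 X
  have hsub := hI.sub (hInt 0) hexp hasImproperIntegral_exp_neg
  have hvolterra (x : ℝ) (hx : 0 ≤ x) : Real.exp (-x) * mittagLeffler β (c * x ^ β) -
      Real.exp (-x) = c * halfLineConv (fun r => Real.exp (-r) * powerKernel β r)
        (fun s => Real.exp (-s) * mittagLeffler β (c * s ^ β)) x := by
    rw [halfLineConv_exp_neg_mul, mittagLeffler_volterra hβ c hx]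
    ring
  linarith [((hasImproperIntegral_congr hvolterra).1 hsub).unique hconv]

theorem integrableOn_exp_neg_mul_mittagLeffler_of_abs_lt_one (hβ : 0 < β) (hc : |c| < 1) :
    IntegrableOn (fun x => Real.exp (-x) * mittagLeffler β (c * x ^ β)) (Set.Ioi 0) := by
  have hβj (j : ℕ) : 0 < β * j + 1 := by positivity
  refine integrable_of_summable_integral_norm
    (F := fun (j : ℕ) x => c ^ j * (Real.exp (-x) * powerKernel (β * j + 1) x))
    (fun j => (integrableOn_exp_neg_mul_powerKernel (hβj j)).const_mul _) ?_
    (continuous_exp_neg_mul_mittagLeffler hβ c).aestronglyMeasurable ?_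
  · have hterm (j : ℕ) : ∫ x in Set.Ioi 0,
        ‖c ^ j * (Real.exp (-x) * powerKernel (β * j + 1) x)‖ = |c| ^ j := by
      have hnonneg : ∀ x ∈ Set.Ioi (0 : ℝ),
          ‖Real.exp (-x) * powerKernel (β * j + 1) x‖ = Real.exp (-x) * powerKernel (β * j + 1) x :=
        fun x hx => Real.norm_of_nonneg
          (mul_nonneg (Real.exp_pos _).le (powerKernel_nonneg (hβj j) (Set.mem_Ioi.1 hx).le))
      simp only [norm_mul (c ^ j), norm_pow, Real.norm_eq_abs c]
      rw [integral_const_mul, setIntegral_congr_fun measurableSet_Ioi hnonneg,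
        integral_exp_neg_mul_powerKernel (hβj j), mul_one]
    simpa only [hterm] using summable_geometric_of_lt_one (abs_nonneg c) hc
  · filter_upwards [ae_restrict_mem measurableSet_Ioi] with x hx
    simpa only [mul_left_comm] using
      (hasSum_mittagLeffler_mul_rpow hβ c (Set.mem_Ioi.1 hx).le).mul_left (Real.exp (-x))

theorem integrableOn_exp_neg_mul_mittagLeffler_of_nonpos (hβ : 0 < β) (hβ₁ : β ≤ 1)
    (hc : c ≤ 0) :
    IntegrableOn (fun x => Real.exp (-x) * mittagLeffler β (c * x ^ β)) (Set.Ioi 0) := by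
  refine Integrable.mono' (integrableOn_exp_neg_Ioi 0)
    (continuous_exp_neg_mul_mittagLeffler hβ c).aestronglyMeasurable ?_
  filter_upwards [ae_restrict_mem measurableSet_Ioi] with x hx
  have hx₀ : 0 ≤ x := (Set.mem_Ioi.1 hx).le
  rw [Real.norm_of_nonneg
    (mul_nonneg (Real.exp_pos _).le (mittagLeffler_mul_rpow_pos hβ hβ₁ hc hx₀).le)]
  exact mul_le_of_le_one_right (Real.exp_pos _).le (mittagLeffler_mul_rpow_le_one hβ hβ₁ hc hx₀)

theorem hasImproperIntegral_exp_neg_mul_mittagLeffler (hβ : 0 < β)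
    (hc : c ≤ 0 ∧ β ≤ 1 ∨ |c| < 1) :
    HasImproperIntegral (fun x => Real.exp (-x) * mittagLeffler β (c * x ^ β)) (1 / (1 - c)) := by
  have hInt : IntegrableOn (fun x => Real.exp (-x) * mittagLeffler β (c * x ^ β)) (Set.Ioi 0) := by
    rcases hc with ⟨hc, hβ₁⟩ | hc
    · exact integrableOn_exp_neg_mul_mittagLeffler_of_nonpos hβ hβ₁ hc
    · exact integrableOn_exp_neg_mul_mittagLeffler_of_abs_lt_one hβ hc
  have hI := hasImproperIntegral_of_integrableOn hInt
  have hval := one_sub_mul_eq_one_of_hasImproperIntegral_mittagLeffler hβ hI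
  rwa [eq_one_div_of_mul_eq_one_right hval] at hI

end Laplace

/-! ### The fractal Sumudu transform -/

section Sumudu

variable {F : Set ℝ} {α l a β v c : ℝ} {g : ℝ → ℝ}

theorem hasImproperIntegral_exp_neg_mul_one_sub_iff (hg : Continuous g) :
    HasImproperIntegral (fun x => Real.exp (-x) * (1 - g x)) c ↔
      HasImproperIntegral (fun x => Real.exp (-x) * g x) (1 - c) := by
  have hexp : Continuous fun x : ℝ => Real.exp (-x) := Real.continuous_exp.comp continuous_neg
  have hcompl {f : ℝ → ℝ} {d : ℝ} (hf : Continuous f) (hd : HasImproperIntegral f d) :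
      HasImproperIntegral (fun x => Real.exp (-x) - f x) (1 - d) :=
    hasImproperIntegral_exp_neg.sub (hexp.intervalIntegrable 0) (hf.intervalIntegrable 0) hd
  simp only [mul_one_sub]
  refine ⟨fun hc => ?_, fun hc => ?_⟩
  · simpa only [sub_sub_cancel] using hcompl (by fun_prop) hc
  · simpa only [sub_sub_cancel] using hcompl (by fun_prop) hc

theorem mittagLefflerNegPow_eq_mittagLeffler (hα : 0 < α) (hF : LocallyFiniteMass F α)
    (hzero : staircase F α l 0 = 0) (htop : Tendsto (staircase F α l) atTop atTop) (hβ : 0 < β)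
    (a t : ℝ) :
    mittagLefflerNegPow F α l a β t = mittagLeffler β (-a * staircase F α l t ^ β) :=
  tsum_congr fun j => by
    rw [fractalGamma_eq_Gamma hα hF hzero htop (le_add_of_nonneg_left (by positivity))]

theorem hasFractalSumudu_mittagLefflerNegPow_iff (hα : 0 < α) (hF : LocallyFiniteMass F α)
    (hzero : staircase F α l 0 = 0) (htop : Tendsto (staircase F α l) atTop atTop) (hβ : 0 < β)
    (hv : 0 < staircase F α l v) :
    HasFractalSumudu F α l (fun t => mittagLefflerNegPow F α l a β t) v c ↔
      HasImproperIntegral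
        (fun x => Real.exp (-x) * mittagLeffler β (-(a * staircase F α l v ^ β) * x ^ β)) c := by
  simp only [mittagLefflerNegPow_eq_mittagLeffler hα hF hzero htop hβ]
  rw [hasFractalSumudu_comp_staircase_iff hα hF hzero htop
    (continuous_mittagLeffler_mul_rpow hβ (-a)) hv]
  refine hasImproperIntegral_congr fun x hx => ?_
  rw [Real.mul_rpow hv.le hx, neg_mul, neg_mul, mul_assoc]

theorem hasFractalSumudu_one_sub_mittagLefflerNegPow_iff (hα : 0 < α)
    (hF : LocallyFiniteMass F α) (hzero : staircase F α l 0 = 0)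
    (htop : Tendsto (staircase F α l) atTop atTop) (hβ : 0 < β) (hv : 0 < staircase F α l v) :
    HasFractalSumudu F α l (fun t => 1 - mittagLefflerNegPow F α l a β t) v c ↔
      HasFractalSumudu F α l (fun t => mittagLefflerNegPow F α l a β t) v (1 - c) := by
  have hcont := continuous_mittagLeffler_mul_rpow hβ (-a)
  simp only [mittagLefflerNegPow_eq_mittagLeffler hα hF hzero htop hβ]
  rw [hasFractalSumudu_comp_staircase_iff (g := fun u => 1 - mittagLeffler β (-a * u ^ β))
      hα hF hzero htop (continuous_const.sub hcont) hv,
    hasFractalSumudu_comp_staircase_iff hα hF hzero htop hcont hv]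
  exact hasImproperIntegral_exp_neg_mul_one_sub_iff (hcont.comp (continuous_const_mul _))

theorem hasFractalSumudu_mittagLefflerNegPow (hα : 0 < α) (hF : LocallyFiniteMass F α)
    (hzero : staircase F α l 0 = 0) (htop : Tendsto (staircase F α l) atTop atTop) (hβ : 0 < β)
    (hv : 0 < staircase F α l v) (ha : 0 ≤ a ∧ β ≤ 1 ∨ |a| * staircase F α l v ^ β < 1) :
    HasFractalSumudu F α l (fun t => mittagLefflerNegPow F α l a β t) v
      (1 / (1 + a * staircase F α l v ^ β)) := by
  have hpow : 0 ≤ staircase F α l v ^ β := Real.rpow_nonneg hv.le β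
  rw [hasFractalSumudu_mittagLefflerNegPow_iff hα hF hzero htop hβ hv, ← sub_neg_eq_add]
  refine hasImproperIntegral_exp_neg_mul_mittagLeffler hβ (ha.imp (fun ha => ?_) fun ha => ?_)
  · exact ⟨neg_nonpos.2 (mul_nonneg ha.1 hpow), ha.2⟩
  · rwa [abs_neg, abs_mul, abs_of_nonneg hpow]

theorem HasFractalSumudu.ne_zero_and_eq_one_div (hα : 0 < α) (hF : LocallyFiniteMass F α)
    (hzero : staircase F α l 0 = 0) (htop : Tendsto (staircase F α l) atTop atTop) (hβ : 0 < β)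
    (hv : 0 < staircase F α l v)
    (hc : HasFractalSumudu F α l (fun t => mittagLefflerNegPow F α l a β t) v c) :
    1 + a * staircase F α l v ^ β ≠ 0 ∧ c = 1 / (1 + a * staircase F α l v ^ β) := by
  rw [hasFractalSumudu_mittagLefflerNegPow_iff hα hF hzero htop hβ hv] at hc
  have hval := one_sub_mul_eq_one_of_hasImproperIntegral_mittagLeffler hβ hc
  rw [sub_neg_eq_add] at hval
  exact ⟨left_ne_zero_of_mul_eq_one hval, eq_one_div_of_mul_eq_one_right hval⟩

end Sumudu

theorem lemma2p16 (F : Set ℝ) (α l : ℝ) (hα0 : 0 < α) (hα1 : α ≤ 1)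
    (hfin : ∀ x y : ℝ, x ≤ y → massFunction F α x y ≠ ∞)
    (hzero : staircase F α l 0 = 0)
    (htop : Tendsto (staircase F α l) atTop atTop)
    (a β : ℝ) (hβ : 0 < β) (v : ℝ) (hv : 0 < staircase F α l v) :
    -- the two transforms exist, with the stated values
    ((0 ≤ a ∧ β ≤ 1 ∨ |a| * staircase F α l v ^ β < 1) →
      HasFractalSumudu F α l (fun t => mittagLefflerNegPow F α l a β t) v
        (1 / (1 + a * staircase F α l v ^ β)) ∧
      HasFractalSumudu F α l (fun t => 1 - mittagLefflerNegPow F α l a β t) v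
        (a * staircase F α l v ^ β / (1 + a * staircase F α l v ^ β))) ∧
    -- whenever one of the transforms exists, it has the stated value
    (∀ c : ℝ, HasFractalSumudu F α l (fun t => mittagLefflerNegPow F α l a β t) v c →
      1 + a * staircase F α l v ^ β ≠ 0 ∧ c = 1 / (1 + a * staircase F α l v ^ β)) ∧
    (∀ c : ℝ, HasFractalSumudu F α l (fun t => 1 - mittagLefflerNegPow F α l a β t) v c →
      1 + a * staircase F α l v ^ β ≠ 0 ∧
        c = a * staircase F α l v ^ β / (1 + a * staircase F α l v ^ β)) := by
  have hcompl (h : 1 + a * staircase F α l v ^ β ≠ 0) :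
      1 - 1 / (1 + a * staircase F α l v ^ β) =
        a * staircase F α l v ^ β / (1 + a * staircase F α l v ^ β) := by
    field_simp
    ring
  have hvalue {c : ℝ}
      (hc : HasFractalSumudu F α l (fun t => mittagLefflerNegPow F α l a β t) v c) :=
    hc.ne_zero_and_eq_one_div hα0 hfin hzero htop hβ hv
  simp only [hasFractalSumudu_one_sub_mittagLefflerNegPow_iff hα0 hfin hzero htop hβ hv]
  refine ⟨fun ha => ?_, fun _ => hvalue, fun c hc => ?_⟩
  · have hE := hasFractalSumudu_mittagLefflerNegPow hα0 hfin hzero htop hβ hv ha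
    refine ⟨hE, ?_⟩
    rwa [← hcompl (hvalue hE).1, sub_sub_cancel]
  · obtain ⟨hne, heq⟩ := hvalue hc
    exact ⟨hne, by rw [← hcompl hne, ← heq, sub_sub_cancel]⟩
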